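/- **Setting.** Let $p\ge 3$ be a prime and $N\ge 1$ an integer. Let $\mathfrak G$ be the $p$-adic Vilenkin group: all sequences $x=(x_k)_{k\in\mathbb Z}$ in $\mathbb Z/p$ with only finitely many nonzero terms of negative index, with coordinatewise addition and with the topology in which the subgroups $\mathfrak G_n=\{x: x_k=0 \text{ for } k<n\}$, $n\in\mathbb Z$, form a basis of neighbourhoods of $0$. Let $\mu$ be the Haar measure with $\mu(\mathfrak G_0)=1$, let $(\mathcal A x)_k=x_{k+1}$ be the dilation, and $H_0=\{h\in\mathfrak G: h_k=0\text{ for }k\ge 0\}$. Let $X$ be the group of continuous characters of $\mathfrak G$, $\mathfrak G_n^\perp\subset X$ the annihilator of $\mathfrak G_n$, $\nu$ the Haar measure on $X$ with $\nu(\mathfrak G_0^\perp)=1$, $(\chi\mathcal A^n,x)=(\chi,\mathcal A^nx)$ for $n\in\mathbb Z$, and let $r_n\in X$ be given by $(r_n,x)=e^{2\pi i x_n/p}$. **Multiresolution analysis.** A family of closed subspaces $V_n\subset L_2(\mathfrak G)$, $n\in\mathbb Z$, is an orthogonal MRA if $V_n\subset V_{n+1}$; $\overline{\bigcup_n V_n}=L_2(\mathfrak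 G)$ and $\bigcap_n V_n=\{0\}$; $f\in V_n\iff f(\mathcal A\,\cdot)\in V_{n+1}$; $f\in V_0$ implies $f(\cdot-h)\in V_0$ for all $h\in H_0$; and for some $\varphi\in L_2(\mathfrak G)$ the system $(\varphi(\cdot-h))_{h\in H_0}$ is an orthonormal basis of $V_0$. A function $\varphi\in L_2(\mathfrak G)$ generates an orthogonal MRA if $(\varphi(\cdot-h))_{h\in H_0}$ is an orthonormal system and the closed linear spans $V_n$ of $\{\varphi(\mathcal A^n\cdot-h):h\in H_0\}$ form an orthogonal MRA. **Trees.** Let $T$ be a rooted tree whose vertices are labelled by elements of $\{0,1,\dots,p-1\}$ (different vertices may have equal labels); paths are directed away from the root. $T$ is $N$-valid if the root and all vertices of level $1,\dots,N-1$ have label $0$, and every $N$-tuple of labels is read along exactly one path with $N$ vertices. Its height $H$ is the number of vertices in a longest path starting at the root. Let $\tilde E\subset\mathfrak G_1^\perp$ be the union, over all paths with labels $\alpha_s\to\alpha_{s-1}\to\dots\to\alpha_{-N}$, $s\ge 0$, such that $\alpha_s=\dots=\alpha_{s-N+1}=0$, of the cosets $$\mathfrak G_{-N}^\perp r_{-N}^{\alpha_{j-N}}r_{-N+1}^{\alpha_{j-N+1}}\cdots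 r_0^{\alpha_j},\qquad 0\le j\le s+N,$$ where $\alpha_k:=0$ for $k>s$. **Mask and function generated by the tree.** Let $m_0:X\to\mathbb C$ be any function such that $m_0=1$ on $\mathfrak G_{-N}^\perp$; on $\mathfrak G_1^\perp$ it is constant on cosets of $\mathfrak G_{-N}^\perp$, has $|m_0|=1$ on $\tilde E$ and $m_0=0$ on $\mathfrak G_1^\perp\setminus\tilde E$; and $m_0(\chi r_1^{\alpha_1}\cdots r_s^{\alpha_s})=m_0(\chi)$ for all $\chi\in X$, $s\ge0$ and $\alpha_1,\dots,\alpha_s\in\{0,\dots,p-1\}$. Put $$\hat\varphi(\chi)=\prod_{n=0}^\infty m_0(\chi\mathcal A^{-n}),\qquad \varphi(x)=\int_X\hat\varphi(\chi)\,(\chi,x)\,d\nu(\chi).$$ **Theorem 4.2.** Let $T$ be an $N$-valid tree of height $H$, and let $m_0$ and $\varphi$ be as above. Then the infinite product converges for every $\chi\in X$; $\varphi$ is a step function, supported in $\mathfrak G_{-N}$ and constant on the cosets of $\mathfrak G_{H-2N}$; $\varphi$ is integrable and $\int_{\mathfrak G}\varphi(x)\overline{(\chi,x)}\,d\mu(x)=\hat\varphi(\chi)$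 for all $\chi\in X$; and $\varphi$ generates an orthogonal MRA in $L_2(\mathfrak G)$. -/

import Mathlib

open MeasureTheory Filter Topology

namespace NValidTree

noncomputable section

/-! ### The `p`-adic Vilenkin group -/

/-- Two-sided sequences over `ℤ/p` with only finitely many nonzero entries of negative index. -/
def vilenkinSubgroup (p : ℕ) : AddSubgroup (ℤ → ZMod p) where
  carrier := {x | ∃ m : ℤ, ∀ k < m, x k = 0}
  zero_mem' := ⟨0, fun _ _ => rfl⟩
  add_mem' := by
    rintro x y ⟨m, hm⟩ ⟨n, hn⟩
    refine ⟨min m n, fun k hk => ?_⟩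
    simp [hm k (lt_of_lt_of_le hk (min_le_left _ _)), hn k (lt_of_lt_of_le hk (min_le_right _ _))]
  neg_mem' := by
    rintro x ⟨m, hm⟩
    exact ⟨m, fun k hk => by simp [hm k hk]⟩

/-- The `p`-adic Vilenkin group. (A separate type, because its topology is not the one induced from
the product topology.) -/
def VilenkinGroup (p : ℕ) : Type := vilenkinSubgroup p

instance (p : ℕ) : AddCommGroup (VilenkinGroup p) :=
  inferInstanceAs (AddCommGroup (vilenkinSubgroup p))

/-- The `k`-th coordinate `x_k` of `x`. -/
def coord {p : ℕ} (k : ℤ) : VilenkinGroup p →+ ZMod p where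
  toFun x := x.1 k
  map_zero' := rfl
  map_add' _ _ := rfl

/-- The basic chain of subgroups: `G_n = {x : x_k = 0 for k < n}`. -/
def chain (p : ℕ) (n : ℤ) : AddSubgroup (VilenkinGroup p) where
  carrier := {x | ∀ k < n, coord k x = 0}
  zero_mem' := fun k _ => map_zero (coord k)
  add_mem' := fun {x y} hx hy k hk => by rw [map_add, hx k hk, hy k hk, add_zero]
  neg_mem' := fun {x} hx k hk => by rw [map_neg, hx k hk, neg_zero]

theorem chain_anti (p : ℕ) {m n : ℤ} (h : m ≤ n) : chain p n ≤ chain p m :=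
  fun _ hx k hk => hx k (lt_of_lt_of_le hk h)

/-- The subgroups `G_n` as a basis of neighbourhoods of zero. -/
abbrev chainBasis (p : ℕ) : AddGroupFilterBasis (VilenkinGroup p) :=
  addGroupFilterBasisOfComm (Set.range fun n : ℤ => (chain p n : Set (VilenkinGroup p)))
    (Set.range_nonempty _)
    (by
      rintro _ _ ⟨m, rfl⟩ ⟨n, rfl⟩
      exact ⟨_, ⟨max m n, rfl⟩, fun x hx =>
        ⟨chain_anti p (le_max_left m n) hx, chain_anti p (le_max_right m n) hx⟩⟩)
    (by rintro _ ⟨n, rfl⟩; exact (chain p n).zero_mem)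
    (by
      rintro _ ⟨n, rfl⟩
      refine ⟨_, ⟨n, rfl⟩, ?_⟩
      rintro _ ⟨x, hx, y, hy, rfl⟩
      exact (chain p n).add_mem hx hy)
    (by
      rintro _ ⟨n, rfl⟩
      exact ⟨_, ⟨n, rfl⟩, fun x hx => (chain p n).neg_mem hx⟩)

/-- The topology whose neighbourhoods of `g` are generated by the cosets `g + G_n`. -/
instance (p : ℕ) : TopologicalSpace (VilenkinGroup p) := (chainBasis p).topology

instance (p : ℕ) : IsTopologicalAddGroup (VilenkinGroup p) := (chainBasis p).isTopologicalAddGroup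

theorem chain_mem_nhds_zero (p : ℕ) (n : ℤ) :
    (chain p n : Set (VilenkinGroup p)) ∈ 𝓝 (0 : VilenkinGroup p) :=
  (chainBasis p).mem_nhds_zero ⟨n, rfl⟩

theorem isOpen_chain (p : ℕ) (n : ℤ) : IsOpen (chain p n : Set (VilenkinGroup p)) :=
  (chain p n).isOpen_of_mem_nhds (chain_mem_nhds_zero p n)

theorem nhds_zero_hasBasis (p : ℕ) :
    (𝓝 (0 : VilenkinGroup p)).HasBasis (fun _ : ℤ => True)
      (fun n => (chain p n : Set (VilenkinGroup p))) := by
  refine ⟨fun t => ?_⟩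
  rw [(chainBasis p).nhds_zero_hasBasis.mem_iff]
  constructor
  · rintro ⟨_, ⟨n, rfl⟩, h⟩
    exact ⟨n, trivial, h⟩
  · rintro ⟨n, -, h⟩
    exact ⟨_, ⟨n, rfl⟩, h⟩

theorem continuous_coord {p : ℕ} (k : ℤ) :
    Continuous (coord k : VilenkinGroup p → ZMod p) := by
  refine continuous_of_continuousAt_zero (coord k) ?_
  rw [ContinuousAt, map_zero]
  refine Filter.Tendsto.congr' (f₁ := fun _ => 0) ?_ tendsto_const_nhds
  filter_upwards [chain_mem_nhds_zero p (k + 1)] with x hx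
  exact (hx k (lt_add_one k)).symm

/-- Setting the coordinates of negative index to zero. -/
def truncate {p : ℕ} (y : ℤ → ZMod p) : VilenkinGroup p :=
  ⟨fun k => if k < 0 then 0 else y k, 0, fun _ hk => if_pos hk⟩

theorem isCompact_chain_zero (p : ℕ) [NeZero p] :
    IsCompact (chain p 0 : Set (VilenkinGroup p)) := by
  have hc : Continuous (truncate : (ℤ → ZMod p) → VilenkinGroup p) := by
    rw [continuous_iff_continuousAt]
    intro y
    have hb := (nhds_zero_hasBasis p).comap (fun x => x - truncate y)
    rw [ContinuousAt, show 𝓝 (truncate y) = comap (fun x => x - truncate y) (𝓝 0) from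
      (nhds_translation_sub (truncate y)).symm, hb.tendsto_right_iff]
    intro n _
    have hfin : ∀ᶠ z in 𝓝 y, ∀ k ∈ Finset.Ico (0 : ℤ) n, z k = y k := by
      rw [eventually_all_finset]
      intro k _
      exact (continuous_apply k).continuousAt.eventually_mem
        ((isOpen_discrete {y k}).mem_nhds rfl)
    filter_upwards [hfin] with z hz k hk
    rw [map_sub, sub_eq_zero]
    change (if k < 0 then 0 else z k) = (if k < 0 then 0 else y k)
    split_ifs with h
    · rfl
    · exact hz k (Finset.mem_Ico.2 ⟨not_lt.1 h, hk⟩)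
  have hr : (chain p 0 : Set (VilenkinGroup p)) = Set.range truncate := by
    ext x
    constructor
    · intro hx
      refine ⟨x.1, Subtype.ext (funext fun k => ?_)⟩
      change (if k < 0 then 0 else x.1 k) = x.1 k
      split_ifs with h
      · exact (hx k h).symm
      · rfl
    · rintro ⟨y, rfl⟩ k hk
      exact if_pos hk
  rw [hr]
  exact isCompact_range hc

instance (p : ℕ) [NeZero p] : LocallyCompactSpace (VilenkinGroup p) :=
  (isCompact_chain_zero p).locallyCompactSpace_of_mem_nhds_of_addGroup (chain_mem_nhds_zero p 0)

instance (p : ℕ) : MeasurableSpace (VilenkinGroup p) := borel _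

instance (p : ℕ) : BorelSpace (VilenkinGroup p) := ⟨rfl⟩

/-- The Haar measure `μ` on the Vilenkin group, normalized by `μ(G_0) = 1`. -/
def haarG (p : ℕ) [NeZero p] : Measure (VilenkinGroup p) :=
  Measure.addHaarMeasure ⟨⟨chain p 0, isCompact_chain_zero p⟩,
    ⟨0, mem_interior_iff_mem_nhds.2 (chain_mem_nhds_zero p 0)⟩⟩

/-- The `n`-th power `𝒜^n` (`n ∈ ℤ`) of the dilation operator `𝒜`, `(𝒜 x)_k = x_{k+1}`, that is
`𝒜 (∑ a_k g_k) = ∑ a_k g_{k-1}`. -/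
def dil {p : ℕ} (n : ℤ) : VilenkinGroup p →ₜ+ VilenkinGroup p where
  toFun x := ⟨fun k => coord (k + n) x, by
    obtain ⟨m, hm⟩ := x.2
    exact ⟨m - n, fun k hk => hm (k + n) (by lia)⟩⟩
  map_zero' := rfl
  map_add' _ _ := rfl
  continuous_toFun := by
    let f : VilenkinGroup p →+ VilenkinGroup p :=
      { toFun := fun x => ⟨fun k => coord (k + n) x, by
          obtain ⟨m, hm⟩ := x.2
          exact ⟨m - n, fun k hk => hm (k + n) (by lia)⟩⟩
        map_zero' := rfl
        map_add' := fun _ _ => rfl }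
    refine continuous_of_continuousAt_zero f ?_
    rw [ContinuousAt, map_zero, (nhds_zero_hasBasis p).tendsto_right_iff]
    intro m _
    filter_upwards [chain_mem_nhds_zero p (m + n)] with x hx k hk
    exact hx (k + n) (by lia)

theorem coord_dil {p : ℕ} (n k : ℤ) (x : VilenkinGroup p) :
    coord k (dil n x) = coord (k + n) x := rfl

theorem dil_zero {p : ℕ} (x : VilenkinGroup p) : dil 0 x = x :=
  Subtype.ext (funext fun k => congrArg x.1 (add_zero k))

theorem dil_add {p : ℕ} (m n : ℤ) (x : VilenkinGroup p) : dil (m + n) x = dil m (dil n x) :=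
  Subtype.ext (funext fun k => congrArg x.1 (by ring))

/-- The set `H_0` of finite sums `a_{-1} g_{-1} + ⋯ + a_{-s} g_{-s}`: the elements of the group
all of whose coordinates of nonnegative index vanish. -/
def H0 (p : ℕ) : Set (VilenkinGroup p) := {h | ∀ k : ℤ, 0 ≤ k → coord k h = 0}

/-! ### Characters -/

/-- The group `X` of (continuous, unitary) characters. -/
abbrev CharGroup (p : ℕ) : Type := PontryaginDual (Multiplicative (VilenkinGroup p))

/-- The value `(χ, x)`. -/
def pairing {p : ℕ} (χ : CharGroup p) (x : VilenkinGroup p) : ℂ :=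
  (χ (Multiplicative.ofAdd x) : Circle)

/-- The annihilator `G_n^⊥`. -/
def annihilator (p : ℕ) (n : ℤ) : Subgroup (CharGroup p) where
  carrier := {χ | ∀ x ∈ chain p n, χ (Multiplicative.ofAdd x) = 1}
  one_mem' := fun _ _ => rfl
  mul_mem' := fun {χ ψ} hχ hψ x hx => by
    change χ _ * ψ _ = 1
    rw [hχ x hx, hψ x hx, one_mul]
  inv_mem' := fun {χ} hχ x hx => by
    change (χ _)⁻¹ = 1
    rw [hχ x hx, inv_one]

/-- The Rademacher character `r_n`, `(r_n, x) = exp (2 π i x_n / p)`. -/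
def rademacher (p : ℕ) [NeZero p] (n : ℤ) : CharGroup p :=
  ({ toFun := fun x => ZMod.toCircle (coord n x.toAdd)
     map_one' := by simp
     map_mul' := fun x y => by simp [AddChar.map_add_eq_mul]
     continuous_toFun := continuous_of_discreteTopology.comp
      ((continuous_coord n).comp continuous_toAdd) } :
    Multiplicative (VilenkinGroup p) →ₜ* Circle)

/-- `χ ↦ χ 𝒜^n`, where `(χ 𝒜^n, x) = (χ, 𝒜^n x)`. -/
def charDil {p : ℕ} (n : ℤ) (χ : CharGroup p) : CharGroup p :=
  PontryaginDual.map
    ({ toFun := fun x => Multiplicative.ofAdd (dil n x.toAdd)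
       map_one' := by simp
       map_mul' := fun x y => by simp
       continuous_toFun :=
        continuous_ofAdd.comp ((dil (p := p) n).continuous_toFun.comp continuous_toAdd) } :
      Multiplicative (VilenkinGroup p) →ₜ* Multiplicative (VilenkinGroup p)) χ

theorem isOpen_annihilator_zero (p : ℕ) [NeZero p] :
    IsOpen (annihilator p 0 : Set (CharGroup p)) := by
  have hV : IsOpen {χ : CharGroup p | Set.MapsTo χ
      (Multiplicative.toAdd ⁻¹' (chain p 0 : Set (VilenkinGroup p)))
      (Circle.centeredArc (Real.pi / 2))} := by
    refine isOpen_induced (ContinuousMap.isOpen_setOfPred_mapsTo ?_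
      (Circle.isOpen_centeredArc (Real.pi / 2)))
    exact isCompact_chain_zero p
  convert hV using 1
  ext χ
  constructor
  · intro h x hx
    rw [show χ x = 1 from h x.toAdd hx, Circle.mem_centeredArc (by linarith [Real.pi_pos])]
    simp [Real.pi_pos]
  · intro h x hx
    refine Circle.eq_one_of_forall_pow_mem_centeredArc_pi_div_two fun n _ => ?_
    rw [← map_pow]
    refine h ?_
    change n • x ∈ chain p 0
    exact (chain p 0).nsmul_mem hx n

theorem isCompact_annihilator_zero (p : ℕ) :
    IsCompact (annihilator p 0 : Set (CharGroup p)) := by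
  let K : Subgroup (Multiplicative (VilenkinGroup p)) := AddSubgroup.toSubgroup (chain p 0)
  have hK : IsOpen (K : Set (Multiplicative (VilenkinGroup p))) := isOpen_chain p 0
  have : DiscreteTopology (Multiplicative (VilenkinGroup p) ⧸ K) :=
    QuotientGroup.discreteTopology hK
  let q : Multiplicative (VilenkinGroup p) →ₜ* (Multiplicative (VilenkinGroup p) ⧸ K) :=
    { QuotientGroup.mk' K with continuous_toFun := QuotientGroup.continuous_mk }
  have hr : (annihilator p 0 : Set (CharGroup p)) = Set.range (PontryaginDual.map q) := by
    ext χ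
    constructor
    · intro hχ
      let f : (Multiplicative (VilenkinGroup p) ⧸ K) →* Circle :=
        QuotientGroup.lift K (χ : Multiplicative (VilenkinGroup p) →* Circle)
          (fun x hx => hχ x.toAdd hx)
      refine ⟨(⟨f, continuous_of_discreteTopology⟩ :
        (Multiplicative (VilenkinGroup p) ⧸ K) →ₜ* Circle), ?_⟩
      ext x
      rfl
    · rintro ⟨ψ, rfl⟩ x hx
      rw [PontryaginDual.map_apply]
      have : q (Multiplicative.ofAdd x) = 1 := (QuotientGroup.eq_one_iff _).2 hx
      rw [this, map_one]
  rw [hr]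
  exact isCompact_range (PontryaginDual.map q).continuous_toFun

instance (p : ℕ) : MeasurableSpace (CharGroup p) := borel _

instance (p : ℕ) : BorelSpace (CharGroup p) := ⟨rfl⟩

/-- The Haar measure `ν` on the group of characters, normalized by `ν(G_0^⊥) = 1`. -/
def haarX (p : ℕ) [NeZero p] : Measure (CharGroup p) :=
  Measure.haarMeasure ⟨⟨annihilator p 0, isCompact_annihilator_zero p⟩,
    ⟨1, mem_interior_iff_mem_nhds.2
      ((isOpen_annihilator_zero p).mem_nhds (annihilator p 0).one_mem)⟩⟩

/-- The Fourier transform of an integrable function. -/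
def fourierG {p : ℕ} [NeZero p] (f : VilenkinGroup p → ℂ) (χ : CharGroup p) : ℂ :=
  ∫ x, f x * star (pairing χ x) ∂haarG p

/-- The inverse Fourier transform of an integrable function on the group of characters. -/
def inverseFourierX {p : ℕ} [NeZero p] (F : CharGroup p → ℂ) (x : VilenkinGroup p) : ℂ :=
  ∫ χ, F χ * pairing χ x ∂haarX p

/-- The class `𝔇_M(G_K)` of step functions: supported in `G_K`, constant on cosets of `G_M`. -/
def IsStepFunction {p : ℕ} (M K : ℤ) (f : VilenkinGroup p → ℂ) : Prop :=
  (∀ x ∉ chain p K, f x = 0) ∧ ∀ x, ∀ g ∈ chain p M, f (x + g) = f x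

/-! ### Multiresolution analyses -/

/-- The Hilbert space `L_2(𝔊)`. -/
abbrev L2 (p : ℕ) [NeZero p] := Lp ℂ 2 (haarG p)

/-- The function `f` is square integrable and its class belongs to `V`. -/
def FunMem {p : ℕ} [NeZero p] (f : VilenkinGroup p → ℂ) (V : Submodule ℂ (L2 p)) : Prop :=
  ∃ hf : MemLp f 2 (haarG p), hf.toLp f ∈ V

/-- `V_n`: the closed linear span in `L_2(𝔊)` of the functions `φ(𝒜^n x - h)`, `h ∈ H_0`. -/
def mraSpace {p : ℕ} [NeZero p] (φ : VilenkinGroup p → ℂ) (n : ℤ) : Submodule ℂ (L2 p) :=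
  (Submodule.span ℂ {f : L2 p | ∃ h ∈ H0 p, f =ᵐ[haarG p] fun x => φ (dil n x - h)}
    ).topologicalClosure

/-- `(φ(x - h))_{h ∈ H_0}` is an orthonormal system in `L_2(𝔊)`. -/
structure OrthonormalShifts {p : ℕ} [NeZero p] (φ : VilenkinGroup p → ℂ) : Prop where
  memLp : MemLp φ 2 (haarG p)
  norm_one : ∀ h ∈ H0 p, ∫ x, φ (x - h) * star (φ (x - h)) ∂haarG p = 1
  orthogonal : ∀ h ∈ H0 p, ∀ g ∈ H0 p, h ≠ g →
    ∫ x, φ (x - h) * star (φ (x - g)) ∂haarG p = 0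

/-- Multiresolution analysis of `L_2(𝔊)` (orthogonal, by the last axiom). -/
structure IsMRA {p : ℕ} [NeZero p] (V : ℤ → Submodule ℂ (L2 p)) : Prop where
  closed : ∀ n, IsClosed (V n : Set (L2 p))
  mono : ∀ n, V n ≤ V (n + 1)
  dense : Dense (⋃ n, (V n : Set (L2 p)))
  inter : ⋂ n, (V n : Set (L2 p)) = {0}
  dilation : ∀ (n : ℤ) (f : VilenkinGroup p → ℂ),
    FunMem f (V n) ↔ FunMem (fun x => f (dil 1 x)) (V (n + 1))
  shift : ∀ f : VilenkinGroup p → ℂ, FunMem f (V 0) →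
    ∀ h ∈ H0 p, FunMem (fun x => f (x - h)) (V 0)
  scaling : ∃ φ : VilenkinGroup p → ℂ, OrthonormalShifts φ ∧
    (Submodule.span ℂ {f : L2 p | ∃ h ∈ H0 p, f =ᵐ[haarG p] fun x => φ (x - h)}
      ).topologicalClosure = V 0

/-- `φ` generates an orthogonal MRA. -/
structure GeneratesMRA {p : ℕ} [NeZero p] (φ : VilenkinGroup p → ℂ) : Prop where
  orthonormal : OrthonormalShifts φ
  isMRA : IsMRA (mraSpace φ)

/-! ### `N`-valid trees

A rooted tree is given by its ancestor order; `v ⋖ w` says that `w` is a child of `v`. Vertices are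
labelled by the elements of `{0, …, p-1}` (identified with `ℤ/p`), several vertices may carry the
same label. -/

/-- The level of a vertex: the number of edges between the root and the vertex. -/
def level (T : RootedTree) (w : T) : ℕ := sInf {k | Order.pred^[k] w = ⊥}

/-- The height: the number of vertices in a longest path that starts at the root. -/
def height (T : RootedTree) : ℕ := sSup {n | ∃ w : T, n = level T w + 1}

/-- `N`-valid tree: the root and the vertices of level `1, …, N-1` are labelled by `0`, and each
`N`-tuple of labels is read along exactly one descending path with `N` vertices. -/
structure IsNValid {p : ℕ} (N : ℕ) (T : RootedTree) (label : T → ZMod p) : Prop where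
  zero_of_level_lt : ∀ w : T, level T w < N → label w = 0
  existsUnique_path : ∀ a : Fin N → ZMod p, ∃! v : Fin N → T,
    (∀ i j : Fin N, (j : ℕ) = i + 1 → v i ⋖ v j) ∧ ∀ i, label (v i) = a i

/-- The coset `G_{-N}^⊥ r_{-N}^{a_{-N}} r_{-N+1}^{a_{-N+1}} ⋯ r_0^{a_0}`. -/
def tupleCoset {p : ℕ} [NeZero p] (N : ℕ) (a : ℤ → ZMod p) : Set (CharGroup p) :=
  {χ | ∃ ζ ∈ annihilator p (-N), χ = ζ * ∏ k ∈ Finset.Icc (-N : ℤ) 0, rademacher p k ^ (a k).val}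

/-- The digits `α_k`, `-N ≤ k ≤ s`, read along a path
`v 0 → v 1 → ⋯ → v (s + N)` with labels `α_s → α_{s-1} → ⋯ → α_{-N}`, and `α_k = 0` for `k > s`. -/
def pathDigit {p : ℕ} {T : RootedTree} (label : T → ZMod p) (v : ℕ → T) (s : ℕ) (k : ℤ) :
    ZMod p :=
  if k ≤ s then label (v (s - k).toNat) else 0

/-- The set `Ẽ`: the union, over all paths `α_s → ⋯ → α_{-N}` of the tree with
`α_s = ⋯ = α_{s-N+1} = 0`, of the cosets
`G_{-N}^⊥ r_{-N}^{α_{j-N}} ⋯ r_0^{α_j}`, `0 ≤ j ≤ s`, and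
`G_{-N}^⊥ r_{-N}^{α_{j-N}} ⋯ r_{s-j}^{α_s}`, `s < j ≤ s + N`. -/
def treeSet {p : ℕ} [NeZero p] (N : ℕ) (T : RootedTree) (label : T → ZMod p) :
    Set (CharGroup p) :=
  {χ | ∃ (s : ℕ) (v : ℕ → T), (∀ i < s + N, v i ⋖ v (i + 1)) ∧ (∀ i < N, label (v i) = 0) ∧
    ∃ j ≤ s + N, χ ∈ tupleCoset N (fun k => pathDigit label v s (k + j))}

/-- `m₀` is a mask generated by the tree: it equals `1` on `G_{-N}^⊥`, on `G_1^⊥` it is constant on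
cosets of `G_{-N}^⊥`, of modulus `1` on `Ẽ` and `0` off `Ẽ`, and it is extended periodically. -/
structure IsTreeMask {p : ℕ} [NeZero p] (N : ℕ) (T : RootedTree) (label : T → ZMod p)
    (m₀ : CharGroup p → ℂ) : Prop where
  eq_one : ∀ χ ∈ annihilator p (-N), m₀ χ = 1
  const : ∀ χ ∈ annihilator p 1, ∀ ζ ∈ annihilator p (-N), m₀ (ζ * χ) = m₀ χ
  norm_eq_one : ∀ χ ∈ treeSet N T label, ‖m₀ χ‖ = 1
  eq_zero : ∀ χ ∈ annihilator p 1, χ ∉ treeSet N T label → m₀ χ = 0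
  periodic : ∀ (χ : CharGroup p) (s : ℕ) (a : ℕ → ZMod p),
    m₀ (χ * ∏ k ∈ Finset.Icc 1 s, rademacher p k ^ (a k).val) = m₀ χ

/-- `φ̂(χ) = ∏_{n ≥ 0} m₀(χ 𝒜^{-n})`. -/
def phiHat {p : ℕ} (m₀ : CharGroup p → ℂ) (χ : CharGroup p) : ℂ :=
  ∏' n : ℕ, m₀ (charDil (-(n : ℤ)) χ)

/-- The function `φ` with Fourier transform `φ̂`. -/
def generatedFunction {p : ℕ} [NeZero p] (m₀ : CharGroup p → ℂ) : VilenkinGroup p → ℂ :=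
  inverseFourierX (phiHat m₀)

end

end NValidTree

open NValidTree

/-! A character is described by its digits `digit k χ` in `ℤ/p`, the exponents of the Rademacher
characters; they vanish for large `k`, `G_n^⊥` is cut out by the vanishing of those of index at
least `n`, and `χ ↦ χ𝒜^{-n}` shifts them down by `n`. The mask sees only the digits of index `-N, …,
0`, so `φ̂(χ)` is the product of the mask over all windows of `N + 1` consecutive digits beginning
at index `-N` or later.

A factor is nonzero exactly when its window is read from some vertex towards the root
(`IsNValid.mem_treeSet_iff`). Since `N` consecutive labels determine everything above them,
overlapping windows glue: `φ̂(χ) ≠ 0` exactly when all digits from index `-N` on are the labels of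
the ancestors of one vertex. Every `N`-tuple occurs, so the support of `φ̂` is a union of `p^N`
cosets of `G_{-N}^⊥`, one for each string of digits of index `-N, …, -1`, and `φ̂` is a constant of
modulus 1 on each. Labels near the root vanish, which places the support in `G_{H-2N}^⊥`; passing to
the parent shows that it is stable under `χ ↦ χ𝒜^{-1}`. This is `IsTreeMask.exists_frequencySystem`;
the tree plays no further role.

Consequently `φ = p^{-N} ∑ λ_c χ_c 1_{G_{-N}}` with `|λ_c| = 1`. The `χ_c` restrict to all the
characters of `H_0 ∩ G_{-N} ≅ (ℤ/p)^N`, so finite Fourier orthogonality gives orthonormal shifts,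
and its inversion puts each packet `χ_c 1_{G_{-N}}` into `V_0`. Stability under `𝒜^{-1}` gives `V_0
⊆ V_1`. The packet of the trivial coset is the indicator of `G_{-N}`, so all indicators of cosets
lie in some `V_n`, whence density. Finally `V_n` consists of `G_{n+M}`-periodic functions, `M = H -
2N`, so a function in every `V_n` is invariant under all translations, and in `L_2` it must vanish.
-/

namespace NValidTree

noncomputable section

/-! ### Coordinates on the group -/

section Coordinates

variable {p : ℕ}

theorem VilenkinGroup.ext {x y : VilenkinGroup p} (h : ∀ k, coord k x = coord k y) : x = y :=
  Subtype.ext (funext h)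

theorem mem_chain {n : ℤ} {x : VilenkinGroup p} : x ∈ chain p n ↔ ∀ k < n, coord k x = 0 := Iff.rfl

theorem exists_mem_chain (x : VilenkinGroup p) : ∃ m, x ∈ chain p m := by
  obtain ⟨m, hm⟩ := x.2
  exact ⟨m, hm⟩

/-- The element with coordinates `a k` for `n ≤ k < m` and zero elsewhere. -/
def boxVec (n m : ℤ) (a : ℤ → ZMod p) : VilenkinGroup p :=
  ⟨fun k => if n ≤ k ∧ k < m then a k else 0, n, fun k hk => if_neg (by omega)⟩

theorem coord_boxVec (n m : ℤ) (a : ℤ → ZMod p) (k : ℤ) :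
    coord k (boxVec n m a) = if n ≤ k ∧ k < m then a k else 0 := rfl

theorem boxVec_mem_chain (n m : ℤ) (a : ℤ → ZMod p) : boxVec n m a ∈ chain p n :=
  fun k hk => by rw [coord_boxVec, if_neg (by omega)]

theorem boxVec_mem_H0 (n : ℤ) (a : ℤ → ZMod p) : boxVec n 0 a ∈ H0 p :=
  fun k hk => by rw [coord_boxVec, if_neg (by omega)]

theorem sub_boxVec_mem_chain {n : ℤ} (m : ℤ) {x : VilenkinGroup p} (hx : x ∈ chain p n) :
    x - boxVec n m (fun k => coord k x) ∈ chain p m := by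
  intro k hk
  rw [map_sub, coord_boxVec]
  by_cases h : n ≤ k
  · simp [h, hk]
  · simp [h, hx k (by omega)]

theorem H0_sub_mem {x y : VilenkinGroup p} (hx : x ∈ H0 p) (hy : y ∈ H0 p) : x - y ∈ H0 p :=
  fun k hk => by rw [map_sub, hx k hk, hy k hk, sub_zero]

theorem H0_add_mem {x y : VilenkinGroup p} (hx : x ∈ H0 p) (hy : y ∈ H0 p) : x + y ∈ H0 p :=
  fun k hk => by rw [map_add, hx k hk, hy k hk, add_zero]

theorem dil_mem_chain_iff {n m : ℤ} {x : VilenkinGroup p} :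
    dil n x ∈ chain p m ↔ x ∈ chain p (n + m) := by
  constructor
  · intro h k hk
    have := h (k - n) (by omega)
    rwa [coord_dil, sub_add_cancel] at this
  · intro h k hk
    exact h _ (by omega)

theorem dil_neg_dil (n : ℤ) (x : VilenkinGroup p) : dil (-n) (dil n x) = x := by
  rw [← dil_add, neg_add_cancel, dil_zero]

theorem dil_dil_neg (n : ℤ) (x : VilenkinGroup p) : dil n (dil (-n) x) = x := by
  rw [← dil_add, add_neg_cancel, dil_zero]

theorem dil_mem_H0 {n : ℤ} (hn : 0 ≤ n) {x : VilenkinGroup p} (hx : x ∈ H0 p) :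
    dil n x ∈ H0 p :=
  fun k hk => hx (k + n) (by omega)

/-- The `k`-th unit vector. -/
def unitVec (p : ℕ) (k : ℤ) : VilenkinGroup p := boxVec k (k + 1) fun _ => 1

theorem coord_unitVec (k j : ℤ) : coord j (unitVec p k) = if j = k then 1 else 0 := by
  rw [unitVec, coord_boxVec]
  congr 1
  simp only [eq_iff_iff]
  omega

theorem unitVec_mem_chain (k : ℤ) : unitVec p k ∈ chain p k := boxVec_mem_chain _ _ _

theorem nsmul_self_eq_zero (x : VilenkinGroup p) : p • x = 0 :=
  VilenkinGroup.ext fun k => by simp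

theorem boxVec_eq_sum [NeZero p] (n m : ℤ) (a : ℤ → ZMod p) :
    boxVec n m a = ∑ k ∈ Finset.Ico n m, (a k).val • unitVec p k := by
  refine VilenkinGroup.ext fun j => ?_
  rw [map_sum, coord_boxVec]
  simp [coord_unitVec]

theorem dil_unitVec (n k : ℤ) : dil n (unitVec p k) = unitVec p (k - n) :=
  VilenkinGroup.ext fun j => by
    rw [coord_dil, coord_unitVec, coord_unitVec]
    congr 1
    simp only [eq_iff_iff]
    omega

end Coordinates

/-! ### Characters and their digits -/

section Digits

variable {p : ℕ}

/-- A character as an additive character with values in the circle. -/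
def charHom (χ : CharGroup p) : AddChar (VilenkinGroup p) Circle where
  toFun x := χ (Multiplicative.ofAdd x)
  map_zero_eq_one' := map_one χ
  map_add_eq_mul' x y := map_mul χ (Multiplicative.ofAdd x) (Multiplicative.ofAdd y)

theorem charHom_ext {χ ψ : CharGroup p} (h : ∀ x, charHom χ x = charHom ψ x) : χ = ψ :=
  PontryaginDual.ext h

theorem pairing_eq (χ : CharGroup p) (x : VilenkinGroup p) : pairing χ x = (charHom χ x : ℂ) := rfl

theorem mem_annihilator {n : ℤ} {χ : CharGroup p} :
    χ ∈ annihilator p n ↔ ∀ x ∈ chain p n, charHom χ x = 1 := Iff.rfl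

theorem annihilator_mono {m n : ℤ} (h : m ≤ n) : annihilator p m ≤ annihilator p n :=
  fun _ hχ x hx => hχ x (chain_anti p h hx)

theorem charHom_mul (χ ψ : CharGroup p) (x : VilenkinGroup p) :
    charHom (χ * ψ) x = charHom χ x * charHom ψ x := rfl

theorem charHom_one (x : VilenkinGroup p) : charHom (1 : CharGroup p) x = 1 := rfl

theorem charHom_inv (χ : CharGroup p) (x : VilenkinGroup p) :
    charHom χ⁻¹ x = (charHom χ x)⁻¹ := rfl

theorem charHom_charDil (n : ℤ) (χ : CharGroup p) (x : VilenkinGroup p) :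
    charHom (charDil n χ) x = charHom χ (dil n x) := rfl

theorem charHom_prod {ι : Type*} (s : Finset ι) (f : ι → CharGroup p) (x : VilenkinGroup p) :
    charHom (∏ i ∈ s, f i) x = ∏ i ∈ s, charHom (f i) x := by
  classical
  induction s using Finset.induction_on with
  | empty => rfl
  | insert i s hi ih => rw [Finset.prod_insert hi, Finset.prod_insert hi, charHom_mul, ih]

theorem charHom_pow (χ : CharGroup p) (n : ℕ) (x : VilenkinGroup p) :
    charHom (χ ^ n) x = charHom χ x ^ n := by
  induction n with
  | zero => rfl
  | succ n ih => rw [pow_succ, pow_succ, charHom_mul, ih]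

theorem _root_.AddChar.map_finset_sum {A M ι : Type*} [AddCommMonoid A] [CommMonoid M]
    (ψ : AddChar A M) (s : Finset ι) (f : ι → A) : ψ (∑ i ∈ s, f i) = ∏ i ∈ s, ψ (f i) := by
  classical
  induction s using Finset.induction_on with
  | empty => exact AddChar.map_zero_eq_one _
  | insert i s hi ih =>
    rw [Finset.sum_insert hi, Finset.prod_insert hi, AddChar.map_add_eq_mul, ih]

/-- The circle has no small subgroups: by continuity some subgroup `G_m` is mapped into an arc about
1 that contains no nontrivial subgroup. Hence the digits of a character vanish from some index on.
-/
theorem exists_mem_annihilator (χ : CharGroup p) : ∃ m, χ ∈ annihilator p m := by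
  have hc : ContinuousAt (charHom χ) 0 := by
    have : Continuous (charHom χ) := (map_continuous χ).comp continuous_ofAdd
    exact this.continuousAt
  have hπ := Real.pi_pos
  have h1 : Circle.centeredArc (Real.pi / 2) ∈ 𝓝 (charHom χ 0) := by
    refine (Circle.isOpen_centeredArc _).mem_nhds ?_
    rw [AddChar.map_zero_eq_one, Circle.mem_centeredArc (by linarith)]
    simp [hπ]
  obtain ⟨m, -, hm⟩ := (nhds_zero_hasBasis p).mem_iff.1 (hc h1)
  refine ⟨m, fun x hx => Circle.eq_one_of_forall_pow_mem_centeredArc_pi_div_two fun n _ => ?_⟩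
  have : n • x ∈ chain p m := (chain p m).nsmul_mem hx n
  have h2 := hm this
  rwa [Set.mem_preimage, AddChar.map_nsmul_eq_pow] at h2

theorem charHom_eq_of_div_mem {n : ℤ} {χ ψ : CharGroup p} (h : χ * ψ⁻¹ ∈ annihilator p n)
    {x : VilenkinGroup p} (hx : x ∈ chain p n) : charHom χ x = charHom ψ x := by
  have := h x hx
  change charHom (χ * ψ⁻¹) x = 1 at this
  rwa [charHom_mul, charHom_inv, mul_inv_eq_one] at this

variable [NeZero p]

theorem exists_toCircle_eq {z : Circle} (hz : z ^ p = 1) : ∃ a : ZMod p, ZMod.toCircle a = z := by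
  have hu : Units.mk0 (z : ℂ) z.coe_ne_zero ∈ rootsOfUnity p ℂ := by
    rw [mem_rootsOfUnity]
    ext
    simp [← Circle.coe_pow, hz]
  obtain ⟨i, -, hi⟩ := (Complex.mem_rootsOfUnity p _).1 hu
  refine ⟨(i : ZMod p), ?_⟩
  ext
  rw [ZMod.toCircle_natCast, ← Units.val_mk0 z.coe_ne_zero, ← hi]
  congr 1
  ring

theorem exists_digit (k : ℤ) (χ : CharGroup p) :
    ∃ a : ZMod p, ZMod.toCircle a = charHom χ (unitVec p k) :=
  exists_toCircle_eq (by
    rw [← AddChar.map_nsmul_eq_pow, nsmul_self_eq_zero, AddChar.map_zero_eq_one])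

/-- The exponent of the `k`-th Rademacher character in `χ`. -/
def digit (k : ℤ) (χ : CharGroup p) : ZMod p := (exists_digit k χ).choose

theorem toCircle_digit (k : ℤ) (χ : CharGroup p) :
    ZMod.toCircle (digit k χ) = charHom χ (unitVec p k) := (exists_digit k χ).choose_spec

theorem digit_eq_iff {k : ℤ} {χ : CharGroup p} {a : ZMod p} :
    digit k χ = a ↔ charHom χ (unitVec p k) = ZMod.toCircle a := by
  rw [← toCircle_digit, ZMod.injective_toCircle.eq_iff]

theorem digit_mul (k : ℤ) (χ ψ : CharGroup p) : digit k (χ * ψ) = digit k χ + digit k ψ := by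
  rw [digit_eq_iff, AddChar.map_add_eq_mul, toCircle_digit, toCircle_digit, charHom_mul]

theorem digit_one (k : ℤ) : digit k (1 : CharGroup p) = 0 := by
  rw [digit_eq_iff, AddChar.map_zero_eq_one, charHom_one]

theorem digit_inv (k : ℤ) (χ : CharGroup p) : digit k χ⁻¹ = - digit k χ := by
  have := digit_mul k χ χ⁻¹
  rw [mul_inv_cancel, digit_one] at this
  exact (neg_eq_of_add_eq_zero_right this.symm).symm

theorem digit_charDil (n k : ℤ) (χ : CharGroup p) :
    digit k (charDil n χ) = digit (k - n) χ := by
  rw [digit_eq_iff, charHom_charDil, dil_unitVec, toCircle_digit]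

theorem charHom_rademacher (n : ℤ) (x : VilenkinGroup p) :
    charHom (rademacher p n) x = ZMod.toCircle (coord n x) := rfl

/-- The character `∏_{n ≤ k < m} r_k ^ {a_k}`. -/
def boxChar (n m : ℤ) (a : ℤ → ZMod p) : CharGroup p :=
  ∏ k ∈ Finset.Ico n m, rademacher p k ^ (a k).val

theorem charHom_boxChar (n m : ℤ) (a : ℤ → ZMod p) (x : VilenkinGroup p) :
    charHom (boxChar n m a) x = ZMod.toCircle (∑ k ∈ Finset.Ico n m, a k * coord k x) := by
  rw [boxChar, charHom_prod, AddChar.map_finset_sum]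
  refine Finset.prod_congr rfl fun k _ => ?_
  rw [charHom_pow, charHom_rademacher, ← AddChar.map_nsmul_eq_pow, nsmul_eq_mul,
    ZMod.natCast_zmod_val]

theorem digit_boxChar (n m : ℤ) (a : ℤ → ZMod p) (k : ℤ) :
    digit k (boxChar n m a) = if n ≤ k ∧ k < m then a k else 0 := by
  rw [digit_eq_iff, charHom_boxChar]
  congr 1
  simp [coord_unitVec]

/-- Only finitely many coordinates matter: those below `n` vanish, and `χ` is trivial on the tail of
`x` in `G_m`. -/
theorem charHom_eq_of_mem {n m : ℤ} {χ : CharGroup p} {x : VilenkinGroup p}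
    (hχ : χ ∈ annihilator p m) (hx : x ∈ chain p n) :
    charHom χ x = ZMod.toCircle (∑ k ∈ Finset.Ico n m, digit k χ * coord k x) := by
  have h1 := hχ _ (sub_boxVec_mem_chain m hx)
  have h2 : charHom χ x = charHom χ (boxVec n m fun k => coord k x) := by
    conv_lhs => rw [← sub_add_cancel x (boxVec n m fun k => coord k x), AddChar.map_add_eq_mul]
    rw [show charHom χ (x - _) = 1 from h1, one_mul]
  rw [h2, boxVec_eq_sum, AddChar.map_finset_sum, AddChar.map_finset_sum]
  refine Finset.prod_congr rfl fun k _ => ?_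
  rw [AddChar.map_nsmul_eq_pow, ← toCircle_digit, ← AddChar.map_nsmul_eq_pow, nsmul_eq_mul,
    ZMod.natCast_zmod_val, mul_comm]

theorem mem_annihilator_iff_digit {n : ℤ} {χ : CharGroup p} :
    χ ∈ annihilator p n ↔ ∀ k, n ≤ k → digit k χ = 0 := by
  constructor
  · intro h k hk
    rw [digit_eq_iff, AddChar.map_zero_eq_one]
    exact h _ (chain_anti p hk (unitVec_mem_chain k))
  · intro h x hx
    obtain ⟨m, hm⟩ := exists_mem_annihilator χ
    change charHom χ x = 1
    rw [charHom_eq_of_mem hm hx, Finset.sum_eq_zero, AddChar.map_zero_eq_one]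
    intro k hk
    rw [h k (Finset.mem_Ico.1 hk).1, zero_mul]

theorem digit_prod {ι : Type*} (k : ℤ) (s : Finset ι) (f : ι → CharGroup p) :
    digit k (∏ i ∈ s, f i) = ∑ i ∈ s, digit k (f i) := by
  rw [digit_eq_iff, charHom_prod, AddChar.map_finset_sum]
  exact Finset.prod_congr rfl fun i _ => (toCircle_digit _ _).symm

theorem digit_pow (k : ℤ) (χ : CharGroup p) (n : ℕ) : digit k (χ ^ n) = n * digit k χ := by
  rw [digit_eq_iff, charHom_pow, ← toCircle_digit, ← AddChar.map_nsmul_eq_pow, nsmul_eq_mul]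

theorem digit_rademacher (k n : ℤ) : digit k (rademacher p n) = if n = k then 1 else 0 := by
  rw [digit_eq_iff, charHom_rademacher, coord_unitVec]

theorem div_mem_annihilator_iff {n : ℤ} {χ ψ : CharGroup p} :
    χ * ψ⁻¹ ∈ annihilator p n ↔ ∀ k, n ≤ k → digit k χ = digit k ψ := by
  simp [mem_annihilator_iff_digit, digit_mul, digit_inv, add_neg_eq_zero]

theorem rademacher_mem_annihilator {k n : ℤ} (h : k < n) : rademacher p k ∈ annihilator p n :=
  fun x hx => by
    change charHom (rademacher p k) x = 1
    rw [charHom_rademacher, hx k h, AddChar.map_zero_eq_one]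

end Digits

/-! ### Vertices of a tree and their ancestors -/

section Tree

variable {T : RootedTree}

theorem exists_pred_iterate_eq_bot (w : T) : ∃ k, Order.pred^[k] w = ⊥ :=
  IsPredArchimedean.exists_pred_iterate_of_le bot_le

/-- The predecessor of the root is the root itself. Reading labels upwards past the root thus
repeats its label `0`, which matches the convention `α_k = 0` for `k > s`. -/
theorem pred_iterate_bot (i : ℕ) : Order.pred^[i] (⊥ : T) = ⊥ :=
  Function.iterate_fixed Order.pred_bot i

theorem pred_iterate_level (w : T) : Order.pred^[level T w] w = ⊥ :=
  Nat.sInf_mem (exists_pred_iterate_eq_bot w)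

theorem level_le_iff {w : T} {k : ℕ} : level T w ≤ k ↔ Order.pred^[k] w = ⊥ := by
  constructor
  · intro h
    obtain ⟨j, rfl⟩ := Nat.exists_eq_add_of_le' h
    rw [Function.iterate_add_apply, pred_iterate_level, pred_iterate_bot]
  · exact fun h => Nat.sInf_le h

theorem level_pred_iterate (w : T) (i : ℕ) : level T (Order.pred^[i] w) = level T w - i := by
  refine eq_of_forall_ge_iff fun k => ?_
  rw [level_le_iff, ← Function.iterate_add_apply, ← level_le_iff]
  omega

theorem level_bot : level T (⊥ : T) = 0 := Nat.le_zero.1 (level_le_iff.2 rfl)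

theorem pred_iterate_covBy {w : T} {i : ℕ} (h : i < level T w) :
    Order.pred^[i + 1] w ⋖ Order.pred^[i] w := by
  rw [Function.iterate_succ_apply']
  refine Order.pred_covBy_of_not_isMin fun hm => ?_
  have := level_le_iff.2 hm.eq_bot
  omega

theorem pred_iterate_of_covBy {v : ℕ → T} {n i : ℕ} (hv : ∀ i < n, v i ⋖ v (i + 1))
    (hi : i ≤ n) : Order.pred^[i] (v n) = v (n - i) := by
  induction i with
  | zero => rfl
  | succ i ih =>
    rw [Function.iterate_succ_apply', ih (by omega)]
    have := hv (n - (i + 1)) (by omega)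
    rw [show n - (i + 1) + 1 = n - i by omega] at this
    exact this.pred_eq

theorem le_level_of_covBy {v : ℕ → T} {n : ℕ} (hv : ∀ i < n, v i ⋖ v (i + 1)) :
    n ≤ level T (v n) := by
  by_contra! h
  have h1 := pred_iterate_of_covBy hv h.le
  rw [pred_iterate_level] at h1
  have h2 := (hv (n - level T (v n) - 1) (by omega)).lt
  rw [show n - level T (v n) - 1 + 1 = n - level T (v n) by omega, ← h1] at h2
  exact not_lt_bot h2

variable {p N : ℕ} {label : T → ZMod p}

theorem IsNValid.label_bot (hT : IsNValid N T label) (hN : 1 ≤ N) : label ⊥ = 0 :=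
  hT.zero_of_level_lt _ (by rw [level_bot]; omega)

/-- The bounds on the levels guarantee that the `N` ancestors form a genuine path, not one that
stalls at the root. Paths descend while ancestors ascend, hence the index `N - 1 - i`. -/
theorem IsNValid.eq_of_labels (hT : IsNValid N T label) (hN : 1 ≤ N) {w w' : T}
    (hw : N ≤ level T w + 1) (hw' : N ≤ level T w' + 1)
    (h : ∀ i < N, label (Order.pred^[i] w) = label (Order.pred^[i] w')) : w = w' := by
  have key : ∀ u : T, N ≤ level T u + 1 → ∀ i j : Fin N, (j : ℕ) = i + 1 →
      Order.pred^[N - 1 - (i : ℕ)] u ⋖ Order.pred^[N - 1 - (j : ℕ)] u := by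
    intro u hu i j hij
    have := pred_iterate_covBy (w := u) (i := N - 1 - (j : ℕ)) (by omega)
    rwa [show N - 1 - (j : ℕ) + 1 = N - 1 - i by omega] at this
  have := (hT.existsUnique_path fun i => label (Order.pred^[N - 1 - (i : ℕ)] w)).unique
    ⟨key w hw, fun _ => rfl⟩ ⟨key w' hw', fun i => (h _ (by omega)).symm⟩
  simpa using congrFun this ⟨N - 1, by omega⟩

theorem IsNValid.exists_labels (hT : IsNValid N T label) (hN : 1 ≤ N) (c : ℕ → ZMod p) :
    ∃ w : T, N ≤ level T w + 1 ∧ ∀ i < N, label (Order.pred^[i] w) = c i := by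
  obtain ⟨v, ⟨hv, hl⟩, -⟩ := hT.existsUnique_path fun i => c (N - 1 - i)
  let u : ℕ → T := fun i => if h : i < N then v ⟨i, h⟩ else ⊥
  have hu : ∀ i < N - 1, u i ⋖ u (i + 1) := by
    intro i hi
    simp only [u, dif_pos (show i < N by omega), dif_pos (show i + 1 < N by omega)]
    exact hv _ _ rfl
  refine ⟨u (N - 1), ?_, fun i hi => ?_⟩
  · have := le_level_of_covBy hu
    omega
  · rw [pred_iterate_of_covBy hu (by omega)]
    simp only [u, dif_pos (show N - 1 - i < N by omega), hl]
    congr 1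
    omega

/-- Pigeonhole: the windows of `N` labels on the way from `w` to the root are pairwise distinct, and
there are only `p ^ N` tuples. -/
theorem IsNValid.level_le (hT : IsNValid N T label) (hN : 1 ≤ N) [NeZero p] (w : T) :
    level T w ≤ N + p ^ N := by
  by_contra! h
  let f : Fin (level T w + 1 - N) → Fin N → ZMod p :=
    fun i j => label (Order.pred^[(j : ℕ) + i] w)
  have hf : Function.Injective f := by
    intro i i' hii
    have := hT.eq_of_labels hN (w := Order.pred^[(i : ℕ)] w) (w' := Order.pred^[(i' : ℕ)] w)
      (by rw [level_pred_iterate]; omega) (by rw [level_pred_iterate]; omega) fun j hj => by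
        simpa only [f, Function.iterate_add_apply] using congrFun hii ⟨j, hj⟩
    have h1 := congrArg (level T) this
    rw [level_pred_iterate, level_pred_iterate] at h1
    omega
  have := Fintype.card_le_of_injective f hf
  simp only [Fintype.card_fin, Fintype.card_fun, ZMod.card] at this
  omega

/-- The bound on the levels is essential: the supremum defining `height` would be `0` for an
unbounded set. -/
theorem IsNValid.level_lt_height (hT : IsNValid N T label) (hN : 1 ≤ N) [NeZero p] (w : T) :
    level T w < height T := by
  refine Nat.lt_of_succ_le (le_csSup ⟨N + p ^ N + 1, ?_⟩ ⟨w, rfl⟩)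
  rintro _ ⟨w, rfl⟩
  have := hT.level_le hN w
  omega

/-- The labels of the ancestors of a vertex vanish from the height minus `N` on. -/
theorem IsNValid.label_pred_iterate_eq_zero (hT : IsNValid N T label) (hN : 1 ≤ N) [NeZero p]
    (w : T) {i : ℕ} (hi : height T ≤ i + N) : label (Order.pred^[i] w) = 0 :=
  hT.zero_of_level_lt _ (by
    have := hT.level_lt_height hN w
    rw [level_pred_iterate]
    omega)

theorem IsNValid.exists_level_eq (hT : IsNValid N T label) (hN : 1 ≤ N) :
    ∃ z : T, level T z + 1 = N := by
  obtain ⟨w, hw, -⟩ := hT.exists_labels hN 0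
  refine ⟨Order.pred^[level T w + 1 - N] w, ?_⟩
  rw [level_pred_iterate]
  omega

/-- A vertex with label `1` cannot lie on the first `N` levels. This provides a path with `s ≥ 0`,
as the definition of `treeSet` demands even for the coset with all digits zero. -/
theorem IsNValid.exists_le_level (hT : IsNValid N T label) (hN : 1 ≤ N)
    (hp : (1 : ZMod p) ≠ 0) : ∃ z : T, N ≤ level T z := by
  obtain ⟨w, hw, hl⟩ := hT.exists_labels hN 1
  refine ⟨w, not_lt.1 fun h => hp ?_⟩
  rw [← hT.zero_of_level_lt w h]
  exact (hl 0 hN).symm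

/-- Every vertex may be replaced by one of level at least `N - 1` with the same labels. -/
theorem IsNValid.exists_replacement (hT : IsNValid N T label) (hN : 1 ≤ N) (w : T) :
    ∃ w' : T, N ≤ level T w' + 1 ∧
      ∀ i, label (Order.pred^[i] w') = label (Order.pred^[i] w) := by
  by_cases h : N ≤ level T w + 1
  · exact ⟨w, h, fun _ => rfl⟩
  · obtain ⟨z, hz⟩ := hT.exists_level_eq hN
    refine ⟨z, hz.ge, fun i => ?_⟩
    rw [hT.zero_of_level_lt _ (by rw [level_pred_iterate]; omega),
      hT.zero_of_level_lt _ (by rw [level_pred_iterate]; omega)]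

/-- `N` consecutive labels determine all the labels above them. -/
theorem IsNValid.label_eq (hT : IsNValid N T label) (hN : 1 ≤ N) {w w' : T}
    (h : ∀ i < N, label (Order.pred^[i] w) = label (Order.pred^[i] w')) (i : ℕ) :
    label (Order.pred^[i] w) = label (Order.pred^[i] w') := by
  obtain ⟨u, hu, hul⟩ := hT.exists_replacement hN w
  obtain ⟨u', hu', hul'⟩ := hT.exists_replacement hN w'
  rw [← hul, ← hul', hT.eq_of_labels hN hu hu' fun i hi => by rw [hul, hul', h i hi]]

end Tree

/-! ### The set generated by the tree -/

section TreeSet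

variable {p : ℕ} [NeZero p] {N : ℕ} {T : RootedTree} {label : T → ZMod p}

theorem mem_tupleCoset_iff {a : ℤ → ZMod p} {χ : CharGroup p} :
    χ ∈ tupleCoset N a ↔
      χ ∈ annihilator p 1 ∧ ∀ k : ℤ, -N ≤ k → k ≤ 0 → digit k χ = a k := by
  have hI : Finset.Icc (-N : ℤ) 0 = Finset.Ico (-N : ℤ) 1 := by
    ext k
    simp only [Finset.mem_Icc, Finset.mem_Ico]
    omega
  have hb : χ ∈ tupleCoset N a ↔ χ * (boxChar (-N) 1 a)⁻¹ ∈ annihilator p (-N) := by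
    rw [tupleCoset, hI]
    constructor
    · rintro ⟨ζ, hζ, rfl⟩
      rwa [boxChar, mul_inv_cancel_right]
    · exact fun h => ⟨_, h, (inv_mul_cancel_right _ _).symm⟩
  rw [hb, div_mem_annihilator_iff, mem_annihilator_iff_digit]
  constructor
  · refine fun h => ⟨fun k hk => ?_, fun k h1 h2 => ?_⟩
    · rw [h k (by omega), digit_boxChar, if_neg (by omega)]
    · rw [h k h1, digit_boxChar, if_pos (by omega)]
  · rintro ⟨h1, h2⟩ k hk
    rw [digit_boxChar]
    split_ifs with h
    · exact h2 k hk (by omega)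
    · exact h1 k (by omega)

/-- The digits `-N, …, -N + n - 1` of `χ` are the labels of a vertex and of its ancestors. -/
def ReadsUpTo (N : ℕ) (label : T → ZMod p) (n : ℕ) (χ : CharGroup p) : Prop :=
  ∃ w : T, ∀ i < n, digit ((i : ℤ) - N) χ = label (Order.pred^[i] w)

/-- The cosets attached to a path are its windows of `N + 1` labels, read upwards and padded by
zeros above the root. Each such window belongs to a vertex, so membership can be tested on one
vertex and its ancestors. -/
theorem IsNValid.mem_treeSet_iff (hT : IsNValid N T label) (hN : 1 ≤ N)
    (hp : (1 : ZMod p) ≠ 0) {χ : CharGroup p} :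
    χ ∈ treeSet N T label ↔ χ ∈ annihilator p 1 ∧ ReadsUpTo N label (N + 1) χ := by
  constructor
  · rintro ⟨s, v, hv, hz, j, hj, hχ⟩
    rw [mem_tupleCoset_iff] at hχ
    refine ⟨hχ.1, ?_⟩
    by_cases hjs : j ≤ s
    · refine ⟨v (s + N - j), fun i hi => ?_⟩
      rw [hχ.2 _ (by omega) (by omega), pathDigit, if_pos (by omega),
        pred_iterate_of_covBy (fun i hi => hv i (by omega)) (by omega)]
      congr 2
      omega
    -- For `j > s` the window only meets the `N` initial zeros `α_s, …, α_{s-N+1}` and the padding,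
    -- so the root serves as witness.
    · refine ⟨⊥, fun i hi => ?_⟩
      rw [hχ.2 _ (by omega) (by omega), pred_iterate_bot, hT.label_bot hN, pathDigit]
      split_ifs with h
      · exact hz _ (by omega)
      · rfl
  · rintro ⟨h1, w, hw⟩
    by_cases hl : N ≤ level T w
    · refine ⟨level T w - N, fun i => Order.pred^[level T w - i] w, fun i hi => ?_,
        fun i hi => hT.zero_of_level_lt _ (by rw [level_pred_iterate]; omega), 0, by omega,
        mem_tupleCoset_iff.2 ⟨h1, fun k hk hk' => ?_⟩⟩
      · have := pred_iterate_covBy (w := w) (i := level T w - (i + 1)) (by omega)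
        rwa [show level T w - (i + 1) + 1 = level T w - i by omega] at this
      · have := hw (k + N).toNat (by omega)
        rw [show ((k + N).toNat : ℤ) - N = k by omega] at this
        rw [this, pathDigit, if_pos (by omega)]
        congr 3
        omega
    -- Here all labels read are zero but the path to `w` is too short. On a longer path the last
    -- shift `j = s + N` reads only `α_s = 0` and the padding.
    · obtain ⟨z, hzl⟩ := hT.exists_le_level hN hp
      refine ⟨level T z - N, fun i => Order.pred^[level T z - i] z, fun i hi => ?_,
        fun i hi => hT.zero_of_level_lt _ (by rw [level_pred_iterate]; omega),
        level T z, by omega, mem_tupleCoset_iff.2 ⟨h1, fun k hk hk' => ?_⟩⟩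
      · have := pred_iterate_covBy (w := z) (i := level T z - (i + 1)) (by omega)
        rwa [show level T z - (i + 1) + 1 = level T z - i by omega] at this
      · have := hw (k + N).toNat (by omega)
        rw [show ((k + N).toNat : ℤ) - N = k by omega] at this
        rw [this, hT.zero_of_level_lt _ (by rw [level_pred_iterate]; omega), pathDigit]
        split_ifs with h
        · exact (hT.zero_of_level_lt _ (by rw [level_pred_iterate]; omega)).symm
        · rfl

end TreeSet

/-! ### The mask and the infinite product -/

section Mask

variable {p : ℕ} [NeZero p] {N : ℕ} {T : RootedTree} {label : T → ZMod p} {m₀ : CharGroup p → ℂ}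

/-- Periodicity removes the positive digits, through the factor `ρ`; constancy on cosets of
`G_{-N}^⊥` then removes the digits below `-N`. -/
theorem IsTreeMask.eq_boxChar (hm : IsTreeMask N T label m₀) (χ : CharGroup p) :
    m₀ χ = m₀ (boxChar (-N) 1 fun k => digit k χ) := by
  obtain ⟨m, hχ⟩ := exists_mem_annihilator χ
  have hχ' : χ ∈ annihilator p (m.toNat + 1) := annihilator_mono (by omega) hχ
  rw [mem_annihilator_iff_digit] at hχ'
  set ρ : CharGroup p :=
    ∏ k ∈ Finset.Icc 1 m.toNat, rademacher p k ^ (digit (k : ℤ) χ).val with hρ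
  have hdρ : ∀ j, digit j ρ = if 1 ≤ j ∧ j ≤ m.toNat then digit j χ else 0 := by
    intro j
    have : ∀ k ∈ Finset.Icc 1 m.toNat, digit j (rademacher p k ^ (digit (k : ℤ) χ).val) =
        if (k : ℤ) = j then digit j χ else 0 := by
      intro k _
      rw [digit_pow, digit_rademacher, ZMod.natCast_zmod_val]
      split_ifs with h
      · rw [h, mul_one]
      · rw [mul_zero]
    rw [hρ, digit_prod, Finset.sum_congr rfl this]
    split_ifs with h
    · rw [Finset.sum_eq_single j.toNat]
      · rw [if_pos (by omega)]
      · exact fun k _ hk => if_neg (by omega)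
      · exact fun hk => absurd (Finset.mem_Icc.2 (by omega)) hk
    · exact Finset.sum_eq_zero fun k hk => if_neg (by have := Finset.mem_Icc.1 hk; omega)
  have h1 := hm.periodic (χ * ρ⁻¹) m.toNat fun k => digit (k : ℤ) χ
  rw [← hρ, inv_mul_cancel_right] at h1
  have hb : boxChar (-N) 1 (fun k => digit k χ) ∈ annihilator p 1 :=
    mem_annihilator_iff_digit.2 fun k hk => by rw [digit_boxChar, if_neg (by omega)]
  rw [h1, ← hm.const _ hb (χ * ρ⁻¹ * (boxChar (-N) 1 fun k => digit k χ)⁻¹)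
    (div_mem_annihilator_iff.2 ?_), inv_mul_cancel_right]
  intro k hk
  rw [digit_mul, digit_inv, hdρ, digit_boxChar]
  by_cases h0 : k < 1
  · rw [if_neg (by omega), if_pos (by omega), neg_zero, add_zero]
  · rw [if_neg (c := -(N : ℤ) ≤ k ∧ k < 1) (by omega)]
    split_ifs with h2
    · exact add_neg_cancel _
    · rw [hχ' k (by omega), neg_zero, add_zero]

theorem IsTreeMask.congr (hm : IsTreeMask N T label m₀) {χ ψ : CharGroup p}
    (h : ∀ k : ℤ, -N ≤ k → digit k χ = digit k ψ) : m₀ χ = m₀ ψ := by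
  rw [hm.eq_boxChar χ, hm.eq_boxChar ψ]
  congr 1
  refine Finset.prod_congr rfl fun k hk => ?_
  beta_reduce
  rw [h k (Finset.mem_Ico.1 hk).1]

theorem readsUpTo_boxChar_iff {χ : CharGroup p} :
    ReadsUpTo N label (N + 1) (boxChar (-N) 1 fun k => digit k χ) ↔
      ReadsUpTo N label (N + 1) χ := by
  refine exists_congr fun w => forall₂_congr fun i hi => ?_
  rw [digit_boxChar, if_pos (by omega)]

theorem IsTreeMask.norm_eq_one_of_reads (hm : IsTreeMask N T label m₀) (hT : IsNValid N T label)
    (hN : 1 ≤ N) (hp : (1 : ZMod p) ≠ 0) {χ : CharGroup p}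
    (h : ReadsUpTo N label (N + 1) χ) : ‖m₀ χ‖ = 1 := by
  rw [hm.eq_boxChar]
  refine hm.norm_eq_one _ ((hT.mem_treeSet_iff hN hp).2 ⟨?_, readsUpTo_boxChar_iff.2 h⟩)
  exact mem_annihilator_iff_digit.2 fun k hk => by rw [digit_boxChar, if_neg (by omega)]

theorem IsTreeMask.reads_of_ne_zero (hm : IsTreeMask N T label m₀) (hT : IsNValid N T label)
    (hN : 1 ≤ N) (hp : (1 : ZMod p) ≠ 0) {χ : CharGroup p} (h : m₀ χ ≠ 0) :
    ReadsUpTo N label (N + 1) χ := by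
  rw [hm.eq_boxChar] at h
  by_contra h'
  refine h (hm.eq_zero _ ?_ fun ht => h' ?_)
  · exact mem_annihilator_iff_digit.2 fun k hk => by rw [digit_boxChar, if_neg (by omega)]
  · exact readsUpTo_boxChar_iff.1 ((hT.mem_treeSet_iff hN hp).1 ht).2

/-- The shift by `n` eventually moves all nonzero digits below `-N`, where the mask is `1`; the
infinite product is in fact finite. -/
theorem IsTreeMask.exists_eq_one (hm : IsTreeMask N T label m₀) (χ : CharGroup p) :
    ∃ n₀ : ℕ, ∀ n : ℕ, n₀ ≤ n → m₀ (charDil (-(n : ℤ)) χ) = 1 := by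
  obtain ⟨m, hχ⟩ := exists_mem_annihilator χ
  refine ⟨(m + N).toNat, fun n hn => hm.eq_one _ (mem_annihilator_iff_digit.2 fun k hk => ?_)⟩
  rw [digit_charDil]
  exact mem_annihilator_iff_digit.1 hχ _ (by omega)

theorem IsTreeMask.multipliable (hm : IsTreeMask N T label m₀) (χ : CharGroup p) :
    Multipliable fun n : ℕ => m₀ (charDil (-(n : ℤ)) χ) := by
  obtain ⟨n₀, h⟩ := hm.exists_eq_one χ
  exact multipliable_of_ne_finset_one (s := Finset.range n₀) fun n hn =>
    h n (not_lt.1 fun h' => hn (Finset.mem_range.2 h'))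

theorem IsTreeMask.exists_phiHat_eq_prod (hm : IsTreeMask N T label m₀) (χ : CharGroup p) :
    ∃ n₀ : ℕ, ∀ n, n₀ ≤ n → phiHat m₀ χ = ∏ i ∈ Finset.range n, m₀ (charDil (-(i : ℤ)) χ) := by
  obtain ⟨n₀, h⟩ := hm.exists_eq_one χ
  refine ⟨n₀, fun n hn => tprod_eq_prod fun i hi => h i ?_⟩
  have := Finset.mem_range.not.1 hi
  omega

theorem IsTreeMask.phiHat_congr (hm : IsTreeMask N T label m₀) {χ ψ : CharGroup p}
    (h : ∀ k : ℤ, -N ≤ k → digit k χ = digit k ψ) : phiHat m₀ χ = phiHat m₀ ψ := by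
  refine tprod_congr fun n => hm.congr fun k hk => ?_
  rw [digit_charDil, digit_charDil]
  exact h _ (by omega)

theorem IsTreeMask.norm_phiHat_eq_one (hm : IsTreeMask N T label m₀) (hT : IsNValid N T label)
    (hN : 1 ≤ N) (hp : (1 : ZMod p) ≠ 0) {χ : CharGroup p} {w : T}
    (h : ∀ i : ℕ, digit ((i : ℤ) - N) χ = label (Order.pred^[i] w)) : ‖phiHat m₀ χ‖ = 1 := by
  obtain ⟨n₀, hn⟩ := hm.exists_phiHat_eq_prod χ
  rw [hn n₀ le_rfl, norm_prod]
  refine Finset.prod_eq_one fun n _ => hm.norm_eq_one_of_reads hT hN hp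
    ⟨Order.pred^[n] w, fun i _ => ?_⟩
  rw [digit_charDil, ← Function.iterate_add_apply, ← h]
  congr 1
  push_cast
  ring

/-- Each nonzero factor yields a vertex `u n` that reads one window. Consecutive windows share `N`
digits, and these determine all labels above, so every window is read from an ancestor of `u 0`. -/
theorem IsTreeMask.exists_of_phiHat_ne_zero (hm : IsTreeMask N T label m₀)
    (hT : IsNValid N T label) (hN : 1 ≤ N) (hp : (1 : ZMod p) ≠ 0) {χ : CharGroup p}
    (h : phiHat m₀ χ ≠ 0) :
    ∃ w : T, ∀ i : ℕ, digit ((i : ℤ) - N) χ = label (Order.pred^[i] w) := by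
  have hr : ∀ n : ℕ, ∃ w : T, ∀ i < N + 1,
      digit ((n + i : ℕ) - N : ℤ) χ = label (Order.pred^[i] w) := by
    intro n
    obtain ⟨n₀, hn⟩ := hm.exists_phiHat_eq_prod χ
    rw [hn (max n₀ (n + 1)) (le_max_left _ _)] at h
    obtain ⟨w, hw⟩ := hm.reads_of_ne_zero hT hN hp
      (Finset.prod_ne_zero_iff.1 h n (Finset.mem_range.2 (by omega)))
    refine ⟨w, fun i hi => ?_⟩
    rw [← hw i hi, digit_charDil]
    congr 1
    push_cast
    ring
  choose u hu using hr
  refine ⟨u 0, ?_⟩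
  have key : ∀ n : ℕ, ∀ i < n + N, digit ((i : ℤ) - N) χ = label (Order.pred^[i] (u 0)) := by
    intro n
    induction n with
    | zero =>
      intro i hi
      rw [← hu 0 i (by omega), zero_add]
    | succ n ih =>
      intro i hi
      rcases Nat.lt_or_ge i (n + N) with h' | h'
      · exact ih i h'
      · obtain rfl : i = n + N := by omega
        rw [hu n N (by omega), Nat.add_comm n N, Function.iterate_add_apply]
        refine hT.label_eq hN (fun j hj => ?_) N
        rw [← hu n j (by omega), ih (n + j) (by omega), ← Function.iterate_add_apply,
          Nat.add_comm]
  exact fun i => key (i + 1) i (by omega)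

end Mask

/-! ### The frequencies of the generated function -/

section Frequencies

variable {p : ℕ} [NeZero p]

/-- The characters `freq c`, one for each string `c` of digits of index `-N, …, -1`, represent the
cosets of `G_{-N}^⊥` in a set `E ⊆ G_M^⊥` that contains `G_{-N}^⊥` and satisfies `E 𝒜⁻¹ ⊆ E`. -/
structure IsFrequencySystem (N : ℕ) (M : ℤ) (freq : (Fin N → ZMod p) → CharGroup p) : Prop where
  digit_freq : ∀ c (i : Fin N), digit ((i : ℤ) - N) (freq c) = c i
  mem_annihilator : ∀ c, freq c ∈ annihilator p M
  exists_charDil : ∀ c, ∃ c', charDil (-1) (freq c) * (freq c')⁻¹ ∈ annihilator p (-N)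
  freq_zero : freq 0 ∈ annihilator p (-N)

open Classical in
theorem IsTreeMask.exists_frequencySystem {N : ℕ} {T : RootedTree} {label : T → ZMod p}
    {m₀ : CharGroup p → ℂ} (hm : IsTreeMask N T label m₀) (hT : IsNValid N T label)
    (hN : 1 ≤ N) (hp : (1 : ZMod p) ≠ 0) :
    ∃ freq : (Fin N → ZMod p) → CharGroup p, IsFrequencySystem N (height T - 2 * N) freq ∧
      (∀ c, ‖phiHat m₀ (freq c)‖ = 1) ∧
      ∀ χ, phiHat m₀ χ = ∑ c,
        if χ * (freq c)⁻¹ ∈ annihilator p (-N) then phiHat m₀ (freq c) else 0 := by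
  have hex : ∀ c : Fin N → ZMod p, ∃ w : T, ∀ i : Fin N, label (Order.pred^[(i : ℕ)] w) = c i := by
    intro c
    obtain ⟨w, -, hw⟩ := hT.exists_labels hN fun i => if h : i < N then c ⟨i, h⟩ else 0
    exact ⟨w, fun i => by rw [hw i i.2, dif_pos i.2]⟩
  choose u hu using hex
  -- The string `c` is read at a vertex `u c`, and the labels of its ancestors continue it. They
  -- vanish from step `height T - N` on, that is, from digit index `height T - 2 * N` on.
  let freq : (Fin N → ZMod p) → CharGroup p := fun c =>
    boxChar (-N) (height T - 2 * N) fun k => label (Order.pred^[(k + N).toNat] (u c))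
  have hd : ∀ c (i : ℕ), digit ((i : ℤ) - N) (freq c) = label (Order.pred^[i] (u c)) := by
    intro c i
    rw [digit_boxChar]
    split_ifs with h
    · congr 2
      omega
    · exact (hT.label_pred_iterate_eq_zero hN _ (by omega)).symm
  have huniq : ∀ (χ : CharGroup p) (w : T),
      (∀ i : ℕ, digit ((i : ℤ) - N) χ = label (Order.pred^[i] w)) → ∀ c : Fin N → ZMod p,
      (χ * (freq c)⁻¹ ∈ annihilator p (-N) ↔ c = fun i : Fin N => digit ((i : ℤ) - N) χ) := by
    intro χ w hw c
    rw [div_mem_annihilator_iff]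
    constructor
    · intro h
      funext i
      rw [h _ (by omega), hd, hu]
    · rintro rfl k hk
      obtain ⟨i, rfl⟩ : ∃ i : ℕ, k = i - N := ⟨(k + N).toNat, by omega⟩
      rw [hw, hd]
      exact hT.label_eq hN (fun j hj => by rw [← hw, hu _ ⟨j, hj⟩]) i
  refine ⟨freq, ⟨fun c i => by rw [hd, hu], fun c => ?_, fun c => ?_, ?_⟩,
    fun c => hm.norm_phiHat_eq_one hT hN hp (hd c), fun χ => ?_⟩
  · exact mem_annihilator_iff_digit.2 fun k hk => by rw [digit_boxChar, if_neg (by omega)]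
  -- The digits shifted by one are read from the parent of `u c`.
  · refine ⟨_, (huniq _ (Order.pred (u c)) (fun i => ?_) _).2 rfl⟩
    rw [digit_charDil, ← Function.iterate_succ_apply, ← hd]
    congr 1
    push_cast
    ring
  · have := (huniq 1 ⊥ (fun i => ?_) 0).2 (funext fun i => (digit_one _).symm)
    · rw [one_mul] at this
      exact inv_mem_iff.1 this
    · rw [digit_one, pred_iterate_bot, hT.label_bot hN]
  · by_cases h0 : phiHat m₀ χ = 0
    · rw [h0, Finset.sum_eq_zero]
      intro c _
      split_ifs with h
      · rw [← h0]
        exact (hm.phiHat_congr (div_mem_annihilator_iff.1 h)).symm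
      · rfl
    · obtain ⟨w, hw⟩ := hm.exists_of_phiHat_ne_zero hT hN hp h0
      simp only [huniq χ w hw]
      rw [Finset.sum_ite_eq' Finset.univ, if_pos (Finset.mem_univ _)]
      exact hm.phiHat_congr (div_mem_annihilator_iff.1 ((huniq χ w hw _).2 rfl))

end Frequencies

/-! ### Haar measures of the basic subgroups -/

section Haar

variable {p : ℕ} [NeZero p]

instance : (haarG p).IsAddHaarMeasure := by
  unfold haarG
  infer_instance

instance : (haarG p).Regular := by
  unfold haarG
  infer_instance

instance : (haarX p).IsHaarMeasure := by
  unfold haarX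
  infer_instance

omit [NeZero p] in
theorem isClosed_chain (n : ℤ) : IsClosed (chain p n : Set (VilenkinGroup p)) :=
  AddSubgroup.isClosed_of_isOpen _ (isOpen_chain p n)

theorem isCompact_chain (n : ℤ) : IsCompact (chain p n : Set (VilenkinGroup p)) := by
  have : (chain p n : Set (VilenkinGroup p)) = dil (-n) '' (chain p 0 : Set (VilenkinGroup p)) := by
    ext x
    constructor
    · intro hx
      exact ⟨dil n x, dil_mem_chain_iff.2 (by simpa using hx), dil_neg_dil n x⟩
    · rintro ⟨y, hy, rfl⟩
      exact dil_mem_chain_iff.2 (by simpa using hy)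
  rw [this]
  exact (isCompact_chain_zero p).image (dil (-n)).continuous_toFun

omit [NeZero p] in
theorem measurableSet_chain (n : ℤ) : MeasurableSet (chain p n : Set (VilenkinGroup p)) :=
  (isOpen_chain p n).measurableSet

omit [NeZero p] in
theorem continuous_charHom_apply (x : VilenkinGroup p) :
    Continuous fun χ : CharGroup p => charHom χ x := by
  have he : Continuous fun f : C(Multiplicative (VilenkinGroup p), Circle) =>
      f (Multiplicative.ofAdd x) := continuous_eval_const _
  have h : Continuous (ContinuousMonoidHom.toContinuousMap :
      (Multiplicative (VilenkinGroup p) →ₜ* Circle) → _) := continuous_induced_dom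
  exact he.comp h

omit [NeZero p] in
theorem continuous_pairing_left (x : VilenkinGroup p) :
    Continuous fun χ : CharGroup p => pairing χ x :=
  continuous_subtype_val.comp (continuous_charHom_apply x)

omit [NeZero p] in
theorem continuous_pairing (χ : CharGroup p) : Continuous (pairing χ) :=
  continuous_subtype_val.comp ((map_continuous χ).comp continuous_ofAdd)

omit [NeZero p] in
theorem isClosed_annihilator (n : ℤ) : IsClosed (annihilator p n : Set (CharGroup p)) := by
  have : (annihilator p n : Set (CharGroup p)) = ⋂ x ∈ chain p n, {χ | charHom χ x = 1} := by
    ext χ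
    simp only [Set.mem_iInter]
    exact mem_annihilator
  rw [this]
  exact isClosed_biInter fun x _ => isClosed_eq (continuous_charHom_apply x) continuous_const

omit [NeZero p] in
theorem isCompact_annihilator {n : ℤ} (hn : n ≤ 0) :
    IsCompact (annihilator p n : Set (CharGroup p)) :=
  (isCompact_annihilator_zero p).of_isClosed_subset (isClosed_annihilator n)
    (annihilator_mono hn)

theorem sub_nsmul_unitVec_mem_chain_iff {n : ℤ} {x : VilenkinGroup p} {a : ZMod p} :
    x - a.val • unitVec p n ∈ chain p (n + 1) ↔ x ∈ chain p n ∧ coord n x = a := by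
  have hc : ∀ k, coord k (x - a.val • unitVec p n) = coord k x - if k = n then a else 0 := by
    intro k
    rw [map_sub, map_nsmul, coord_unitVec]
    split_ifs <;> simp
  constructor
  · intro h
    refine ⟨fun k hk => ?_, ?_⟩
    · have := h k (by omega)
      rwa [hc, if_neg (by omega), sub_zero] at this
    · have := h n (by omega)
      rwa [hc, if_pos rfl, sub_eq_zero] at this
  · rintro ⟨h1, h2⟩ k hk
    rw [hc]
    split_ifs with h
    · rw [h, h2, sub_self]
    · rw [sub_zero, h1 k (by omega)]

theorem div_rademacher_mem_annihilator_iff {n : ℤ} {χ : CharGroup p} {a : ZMod p} :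
    χ * (rademacher p n ^ a.val)⁻¹ ∈ annihilator p n ↔
      χ ∈ annihilator p (n + 1) ∧ digit n χ = a := by
  have hc : ∀ k, digit k (rademacher p n ^ a.val) = if k = n then a else 0 := by
    intro k
    rw [digit_pow, digit_rademacher]
    split_ifs with h1 h2 h2
    · simp
    · exact absurd h1.symm h2
    · exact absurd h2.symm h1
    · simp
  rw [div_mem_annihilator_iff, mem_annihilator_iff_digit]
  constructor
  · refine fun h => ⟨fun k hk => ?_, ?_⟩
    · rw [h k (by omega), hc, if_neg (by omega)]
    · rw [h n le_rfl, hc, if_pos rfl]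
  · rintro ⟨h1, h2⟩ k hk
    rw [hc]
    split_ifs with h
    · rw [h, h2]
    · exact h1 k (by omega)

/-- The value of the `n`-th coordinate splits `G_n` into `p` cosets of `G_{n+1}`. -/
theorem haarG_chain_eq_mul (n : ℤ) : haarG p (chain p n) = p * haarG p (chain p (n + 1)) := by
  have hU : (chain p n : Set (VilenkinGroup p)) = ⋃ a ∈ (Finset.univ : Finset (ZMod p)),
      (fun x => x + -(a.val • unitVec p n)) ⁻¹' (chain p (n + 1) : Set (VilenkinGroup p)) := by
    ext x
    simp [← sub_eq_add_neg, sub_nsmul_unitVec_mem_chain_iff]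
  rw [hU, measure_biUnion_finset]
  · simp [measure_preimage_add_right]
  · intro a _ b _ hab
    refine Set.disjoint_left.2 fun x hx hx' => hab ?_
    rw [Set.mem_preimage, ← sub_eq_add_neg, SetLike.mem_coe,
      sub_nsmul_unitVec_mem_chain_iff] at hx hx'
    rw [← hx.2, hx'.2]
  · exact fun a _ => (measurable_add_const _) (measurableSet_chain _)

theorem haarX_annihilator_eq_mul (n : ℤ) :
    haarX p (annihilator p (n + 1)) = p * haarX p (annihilator p n) := by
  have hU : (annihilator p (n + 1) : Set (CharGroup p)) =
      ⋃ a ∈ (Finset.univ : Finset (ZMod p)),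
        (fun χ => χ * (rademacher p n ^ a.val)⁻¹) ⁻¹' (annihilator p n : Set (CharGroup p)) := by
    ext x
    simp [div_rademacher_mem_annihilator_iff]
  rw [hU, measure_biUnion_finset]
  · simp [measure_preimage_mul_right]
  · intro a _ b _ hab
    refine Set.disjoint_left.2 fun x hx hx' => hab ?_
    rw [Set.mem_preimage, SetLike.mem_coe, div_rademacher_mem_annihilator_iff] at hx hx'
    rw [← hx.2, hx'.2]
  · exact fun a _ => (measurable_mul_const _) (isClosed_annihilator _).measurableSet

theorem haarG_chain_neg (N : ℕ) : haarG p (chain p (-N)) = (p : ENNReal) ^ N := by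
  induction N with
  | zero =>
    rw [Nat.cast_zero, neg_zero, pow_zero]
    exact Measure.addHaarMeasure_self
  | succ N ih =>
    rw [haarG_chain_eq_mul, show (-((N + 1 : ℕ) : ℤ) + 1) = -N by push_cast; ring, ih, pow_succ']

theorem pow_mul_haarX_annihilator_neg (N : ℕ) :
    (p : ENNReal) ^ N * haarX p (annihilator p (-N)) = 1 := by
  induction N with
  | zero =>
    rw [Nat.cast_zero, neg_zero, pow_zero, one_mul]
    exact Measure.haarMeasure_self
  | succ N ih =>
    rw [← ih, show -(N : ℤ) = -((N + 1 : ℕ) : ℤ) + 1 by push_cast; ring,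
      haarX_annihilator_eq_mul, pow_succ, mul_assoc]

theorem haarG_real_chain_neg (N : ℕ) : (haarG p).real (chain p (-N)) = (p : ℝ) ^ N := by
  simp [Measure.real, haarG_chain_neg]

theorem haarX_real_annihilator_neg (N : ℕ) :
    (haarX p).real (annihilator p (-N)) = ((p : ℝ) ^ N)⁻¹ := by
  have := congrArg ENNReal.toReal (pow_mul_haarX_annihilator_neg (p := p) N)
  rw [ENNReal.toReal_mul, ENNReal.toReal_one] at this
  refine eq_inv_of_mul_eq_one_right ?_
  simpa [Measure.real] using this

end Haar

/-! ### Wave packets: restrictions of characters to subgroups -/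

section Packet

variable {p : ℕ}

open Classical in
/-- The restriction of the character `χ` to `G_n`, extended by zero. -/
def packet (n : ℤ) (χ : CharGroup p) (x : VilenkinGroup p) : ℂ :=
  if x ∈ chain p n then pairing χ x else 0

theorem packet_of_mem {n : ℤ} {χ : CharGroup p} {x : VilenkinGroup p} (hx : x ∈ chain p n) :
    packet n χ x = pairing χ x := if_pos hx

theorem packet_of_notMem {n : ℤ} {χ : CharGroup p} {x : VilenkinGroup p} (hx : x ∉ chain p n) :
    packet n χ x = 0 := if_neg hx

theorem packet_eq_indicator (n : ℤ) (χ : CharGroup p) :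
    packet n χ = (chain p n : Set (VilenkinGroup p)).indicator (pairing χ) := by
  classical
  ext x
  rw [packet, Set.indicator_apply]
  rfl

theorem pairing_mul (χ ψ : CharGroup p) (x : VilenkinGroup p) :
    pairing (χ * ψ) x = pairing χ x * pairing ψ x := by
  rw [pairing_eq, charHom_mul, Circle.coe_mul]
  rfl

theorem pairing_add (χ : CharGroup p) (x y : VilenkinGroup p) :
    pairing χ (x + y) = pairing χ x * pairing χ y := by
  rw [pairing_eq, AddChar.map_add_eq_mul, Circle.coe_mul]
  rfl

theorem pairing_inv (χ : CharGroup p) (x : VilenkinGroup p) :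
    pairing χ⁻¹ x = star (pairing χ x) := by
  rw [pairing_eq, charHom_inv, Circle.coe_inv_eq_conj]
  rfl

theorem pairing_neg (χ : CharGroup p) (x : VilenkinGroup p) :
    pairing χ (-x) = star (pairing χ x) := by
  rw [pairing_eq, AddChar.map_neg_eq_inv, Circle.coe_inv_eq_conj]
  rfl

theorem packet_congr {n : ℤ} {χ ψ : CharGroup p} (h : χ * ψ⁻¹ ∈ annihilator p n) :
    packet n χ = packet n ψ := by
  ext x
  by_cases hx : x ∈ chain p n
  · rw [packet_of_mem hx, packet_of_mem hx, pairing_eq, charHom_eq_of_div_mem h hx]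
    rfl
  · rw [packet_of_notMem hx, packet_of_notMem hx]

theorem packet_mul_star (n : ℤ) (χ ψ : CharGroup p) (x : VilenkinGroup p) :
    packet n χ x * star (packet n ψ x) = packet n (χ * ψ⁻¹) x := by
  by_cases hx : x ∈ chain p n
  · rw [packet_of_mem hx, packet_of_mem hx, packet_of_mem hx, pairing_mul, pairing_inv]
  · rw [packet_of_notMem hx, packet_of_notMem hx, packet_of_notMem hx, zero_mul]

theorem packet_mul_star_pairing (n : ℤ) (χ ψ : CharGroup p) (x : VilenkinGroup p) :
    packet n χ x * star (pairing ψ x) = packet n (χ * ψ⁻¹) x := by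
  by_cases hx : x ∈ chain p n
  · rw [packet_of_mem hx, packet_of_mem hx, pairing_mul, pairing_inv]
  · rw [packet_of_notMem hx, packet_of_notMem hx, zero_mul]

theorem packet_add {n : ℤ} (χ : CharGroup p) (x : VilenkinGroup p) {y : VilenkinGroup p}
    (hy : y ∈ chain p n) : packet n χ (x + y) = packet n χ x * pairing χ y := by
  by_cases hx : x ∈ chain p n
  · rw [packet_of_mem hx, packet_of_mem ((chain p n).add_mem hx hy), pairing_add]
  · rw [packet_of_notMem hx, packet_of_notMem, zero_mul]
    rwa [AddSubgroup.add_mem_cancel_right _ hy]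

theorem packet_sub {n : ℤ} (χ : CharGroup p) (x : VilenkinGroup p) {y : VilenkinGroup p}
    (hy : y ∈ chain p n) : packet n χ (x - y) = packet n χ x * star (pairing χ y) := by
  rw [sub_eq_add_neg, packet_add _ _ ((chain p n).neg_mem hy), pairing_neg]

theorem packet_dil (n m : ℤ) (χ : CharGroup p) (x : VilenkinGroup p) :
    packet n χ (dil m x) = packet (m + n) (charDil m χ) x := by
  by_cases hx : x ∈ chain p (m + n)
  · rw [packet_of_mem hx, packet_of_mem (dil_mem_chain_iff.2 hx)]
    rfl
  · rw [packet_of_notMem hx, packet_of_notMem (mt dil_mem_chain_iff.1 hx)]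

theorem continuous_packet (n : ℤ) (χ : CharGroup p) : Continuous (packet n χ) := by
  rw [packet_eq_indicator]
  exact (continuous_pairing χ).indicator (by
    intro x hx
    rw [IsClopen.frontier_eq ⟨isClosed_chain n, isOpen_chain p n⟩] at hx
    exact hx.elim)

variable [NeZero p]

theorem hasCompactSupport_packet (n : ℤ) (χ : CharGroup p) : HasCompactSupport (packet n χ) :=
  HasCompactSupport.intro (isCompact_chain n) fun _ hx => packet_of_notMem hx

theorem memLp_packet (n : ℤ) (χ : CharGroup p) : MemLp (packet n χ) 2 (haarG p) :=
  (continuous_packet n χ).memLp_of_hasCompactSupport (hasCompactSupport_packet n χ)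

theorem integrable_packet (n : ℤ) (χ : CharGroup p) : Integrable (packet n χ) (haarG p) :=
  (continuous_packet n χ).integrable_of_hasCompactSupport (hasCompactSupport_packet n χ)

-- If `χ` is nontrivial on `G_n`, translation by some `y` in `G_n` with `(χ, y) ≠ 1` multiplies the
-- integral by `(χ, y)` without changing it.
open Classical in
theorem integral_packet (n : ℤ) (χ : CharGroup p) :
    ∫ x, packet n χ x ∂haarG p =
      if χ ∈ annihilator p n then ((haarG p).real (chain p n) : ℂ) else 0 := by
  split_ifs with h
  · rw [packet_congr (ψ := 1) (by simpa using h), packet_eq_indicator,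
      integral_indicator (measurableSet_chain n)]
    have h1 : ∀ x, pairing (1 : CharGroup p) x = 1 := fun x => by
      rw [pairing_eq, charHom_one, Circle.coe_one]
    simp [h1]
  · rw [mem_annihilator] at h
    push Not at h
    obtain ⟨y, hy, hy1⟩ := h
    have h2 := integral_add_right_eq_self (μ := haarG p) (packet n χ) y
    simp only [packet_add χ _ hy] at h2
    rw [integral_mul_const] at h2
    have h3 : pairing χ y ≠ 1 := by
      rw [pairing_eq]
      exact fun h => hy1 (Circle.coe_eq_one.1 h)
    by_contra h0
    exact h3 (mul_left_cancel₀ h0 (by rw [h2, mul_one]))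

open Classical in
theorem integrable_dual_packet {n : ℤ} (hn : n ≤ 0) (x : VilenkinGroup p) :
    Integrable (fun χ : CharGroup p => if χ ∈ annihilator p n then pairing χ x else 0)
      (haarX p) := by
  have : (fun χ : CharGroup p => if χ ∈ annihilator p n then pairing χ x else 0) =
      (annihilator p n : Set (CharGroup p)).indicator fun χ => pairing χ x := by
    ext χ
    rw [Set.indicator_apply]
    rfl
  rw [this, integrable_indicator_iff (isClosed_annihilator n).measurableSet]
  exact (continuous_pairing_left x).continuousOn.integrableOn_compact (isCompact_annihilator hn)

open Classical in
theorem integral_dual_packet (n : ℤ) (x : VilenkinGroup p) :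
    ∫ χ : CharGroup p, (if χ ∈ annihilator p n then pairing χ x else 0) ∂haarX p =
      if x ∈ chain p n then ((haarX p).real (annihilator p n) : ℂ) else 0 := by
  split_ifs with h
  · have : (fun χ : CharGroup p => if χ ∈ annihilator p n then pairing χ x else 0) =
        (annihilator p n : Set (CharGroup p)).indicator fun _ => (1 : ℂ) := by
      ext χ
      by_cases hχ : χ ∈ annihilator p n
      · rw [if_pos hχ, Set.indicator_of_mem hχ, pairing_eq, mem_annihilator.1 hχ x h,
          Circle.coe_one]
      · rw [if_neg hχ, Set.indicator_of_notMem hχ]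
    rw [this, integral_indicator (isClosed_annihilator n).measurableSet]
    simp
  · rw [mem_chain] at h
    push Not at h
    obtain ⟨k, hk, hk0⟩ := h
    -- The dual translation argument: `r_k` lies in `G_n^⊥` and takes a value other than 1 at `x`.
    have hr := rademacher_mem_annihilator (p := p) hk
    have h2 := integral_mul_right_eq_self (μ := haarX p)
      (fun χ : CharGroup p => if χ ∈ annihilator p n then pairing χ x else 0) (rademacher p k)
    simp only [Subgroup.mul_mem_cancel_right _ hr, pairing_mul, ← ite_zero_mul] at h2
    rw [integral_mul_const] at h2
    have h3 : pairing (rademacher p k) x ≠ 1 := by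
      rw [pairing_eq, charHom_rademacher]
      intro h
      rw [Circle.coe_eq_one, ← AddChar.map_zero_eq_one (ZMod.toCircle (N := p)),
        ZMod.injective_toCircle.eq_iff] at h
      exact hk0 h
    by_contra h0
    exact h3 (mul_left_cancel₀ h0 (by rw [h2, mul_one]))

end Packet

/-! ### Finite orthogonality relations -/

section FiniteFourier

variable {p : ℕ} [NeZero p] {N : ℕ}

/-- On `H_0 ∩ G_{-N}`, a copy of `(ℤ/p)^N`, a character is governed by its digits of index `-N, …,
-1` alone. These are the digits that label a frequency system. -/
theorem charHom_eq_of_mem_H0 (χ : CharGroup p) {d : VilenkinGroup p} (hd : d ∈ H0 p)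
    (hdN : d ∈ chain p (-N)) : charHom χ d =
      ZMod.toCircle (∑ i : Fin N, digit ((i : ℤ) - N) χ * coord ((i : ℤ) - N) d) := by
  have h1 : d = boxVec (-N) 0 fun k => coord k d := by
    refine VilenkinGroup.ext fun k => ?_
    rw [coord_boxVec]
    split_ifs with h
    · rfl
    · by_cases hk : k < -N
      · exact hdN k hk
      · exact hd k (by omega)
  conv_lhs => rw [h1, boxVec_eq_sum, AddChar.map_finset_sum]
  rw [AddChar.map_finset_sum]
  refine Finset.prod_bij' (fun k hk => (⟨(k + N).toNat, by
    have := Finset.mem_Ico.1 hk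
    omega⟩ : Fin N)) (fun i _ => (i : ℤ) - N) (fun _ _ => Finset.mem_univ _)
    (fun i _ => Finset.mem_Ico.2 (by omega)) (fun k hk => ?_) (fun i _ => ?_) (fun k hk => ?_)
  · have := Finset.mem_Ico.1 hk
    simp only
    omega
  · ext
    simp
  · have := Finset.mem_Ico.1 hk
    have hk' : (((k + N).toNat : ℕ) : ℤ) - N = k := by omega
    simp only [hk']
    rw [AddChar.map_nsmul_eq_pow, ← toCircle_digit, ← AddChar.map_nsmul_eq_pow, nsmul_eq_mul,
      ZMod.natCast_zmod_val, mul_comm]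

/-- Orthogonality of the characters of `(ℤ/p)^N`. -/
theorem sum_toCircle_dotProduct (d : Fin N → ZMod p) :
    ∑ c : Fin N → ZMod p, (ZMod.toCircle (∑ i, c i * d i) : ℂ) =
      if d = 0 then (p : ℂ) ^ N else 0 := by
  let ψ : AddChar (Fin N → ZMod p) ℂ :=
    { toFun := fun c => ZMod.stdAddChar (∑ i, c i * d i)
      map_zero_eq_one' := by simp
      map_add_eq_mul' := fun a b => by
        simp only [Pi.add_apply, add_mul, Finset.sum_add_distrib, AddChar.map_add_eq_mul] }
  have h0 : ψ = 0 ↔ d = 0 := by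
    constructor
    · intro h
      funext i
      have h1 : ZMod.stdAddChar (∑ j, (Pi.single i 1 : Fin N → ZMod p) j * d j) = (1 : ℂ) :=
        DFunLike.congr_fun h (Pi.single i 1)
      rw [← AddChar.map_zero_eq_one (ZMod.stdAddChar (N := p)),
        ZMod.injective_stdAddChar.eq_iff] at h1
      simpa [Pi.single_apply] using h1
    · rintro rfl
      ext c
      simp [ψ]
  classical
  have := AddChar.sum_eq_ite ψ
  simp only [h0] at this
  simpa [ψ, ZMod.stdAddChar_apply] using this

/-- The element of `H_0 ∩ G_{-N}` with coordinates `b`. -/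
def shiftVec (b : Fin N → ZMod p) : VilenkinGroup p :=
  boxVec (-N) 0 fun k => if h : (k + N).toNat < N then b ⟨(k + N).toNat, h⟩ else 0

omit [NeZero p] in
theorem shiftVec_mem_H0 (b : Fin N → ZMod p) : shiftVec b ∈ H0 p := boxVec_mem_H0 _ _

omit [NeZero p] in
theorem shiftVec_mem_chain (b : Fin N → ZMod p) : shiftVec b ∈ chain p (-N) :=
  boxVec_mem_chain _ _ _

omit [NeZero p] in
theorem coord_shiftVec (b : Fin N → ZMod p) (i : Fin N) :
    coord ((i : ℤ) - N) (shiftVec b) = b i := by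
  rw [shiftVec, coord_boxVec, if_pos (by omega), dif_pos (by omega)]
  congr 1
  ext
  simp

end FiniteFourier

/-! ### Sums of wave packets -/

section PacketSum

variable {p : ℕ} [NeZero p] {N : ℕ} {M : ℤ} {freq : (Fin N → ZMod p) → CharGroup p}
  {lam : (Fin N → ZMod p) → ℂ}

/-- The function with Fourier transform equal to `lam c` on the coset of `freq c`. -/
def packetSum (freq : (Fin N → ZMod p) → CharGroup p) (lam : (Fin N → ZMod p) → ℂ)
    (x : VilenkinGroup p) : ℂ :=
  ((p : ℂ) ^ N)⁻¹ * ∑ c, lam c * packet (-N) (freq c) x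

theorem natCast_pow_ne_zero : (p : ℂ) ^ N ≠ 0 := pow_ne_zero _ (Nat.cast_ne_zero.2 (NeZero.ne p))

-- Translation by `freq c` reduces each summand to the transform of the indicator of `G_{-N}^⊥`,
-- which is `p^{-N}` times the indicator of `G_{-N}`.
open Classical in
theorem inverseFourierX_eq_packetSum {F : CharGroup p → ℂ}
    (hF : ∀ χ, F χ = ∑ c, if χ * (freq c)⁻¹ ∈ annihilator p (-N) then lam c else 0) :
    inverseFourierX F = packetSum freq lam := by
  ext x
  have h1 : ∀ χ, F χ * pairing χ x = ∑ c, lam c * pairing (freq c) x *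
      (fun ψ : CharGroup p => if ψ ∈ annihilator p (-N) then pairing ψ x else 0)
        (χ * (freq c)⁻¹) := by
    intro χ
    rw [hF, Finset.sum_mul]
    refine Finset.sum_congr rfl fun c _ => ?_
    beta_reduce
    split_ifs
    · rw [mul_assoc, ← pairing_mul, mul_comm (freq c), inv_mul_cancel_right]
    · rw [zero_mul, mul_zero]
  have hN : -(N : ℤ) ≤ 0 := by omega
  rw [inverseFourierX]
  simp only [h1]
  rw [integral_finsetSum _ fun c _ =>
    ((integrable_dual_packet hN x).comp_mul_right (freq c)⁻¹).const_mul _]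
  simp only [integral_const_mul]
  rw [packetSum, Finset.mul_sum]
  refine Finset.sum_congr rfl fun c _ => ?_
  rw [integral_mul_right_eq_self (μ := haarX p)
    (fun ψ : CharGroup p => if ψ ∈ annihilator p (-N) then pairing ψ x else 0),
    integral_dual_packet, haarX_real_annihilator_neg, packet]
  split_ifs
  · push_cast
    ring
  · simp

theorem memLp_packetSum : MemLp (packetSum freq lam) 2 (haarG p) :=
  (memLp_finsetSum _ fun c _ => (memLp_packet _ (freq c)).const_mul (lam c)).const_mul _

theorem integrable_packetSum : Integrable (packetSum freq lam) (haarG p) :=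
  (integrable_finsetSum _ fun c _ => (integrable_packet _ (freq c)).const_mul (lam c)).const_mul _

theorem packetSum_of_notMem {x : VilenkinGroup p} (hx : x ∉ chain p (-N)) :
    packetSum freq lam x = 0 := by
  simp [packetSum, packet_of_notMem hx]

open Classical in
theorem fourierG_packetSum (χ : CharGroup p) : fourierG (packetSum freq lam) χ =
    ∑ c, if χ * (freq c)⁻¹ ∈ annihilator p (-N) then lam c else 0 := by
  have h1 : ∀ x, packetSum freq lam x * star (pairing χ x) =
      ∑ c, ((p : ℂ) ^ N)⁻¹ * lam c * packet (-N) (freq c * χ⁻¹) x := by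
    intro x
    rw [packetSum, Finset.mul_sum, Finset.sum_mul]
    refine Finset.sum_congr rfl fun c _ => ?_
    rw [← packet_mul_star_pairing]
    ring
  rw [fourierG]
  simp only [h1]
  rw [integral_finsetSum _ fun c _ => (integrable_packet _ _).const_mul _]
  refine Finset.sum_congr rfl fun c _ => ?_
  rw [integral_const_mul, integral_packet, haarG_real_chain_neg]
  have : freq c * χ⁻¹ ∈ annihilator p (-N) ↔ χ * (freq c)⁻¹ ∈ annihilator p (-N) := by
    rw [← inv_mem_iff, mul_inv_rev, inv_inv]
  simp only [this]
  split_ifs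
  · push_cast
    field_simp [natCast_pow_ne_zero (p := p) (N := N)]
  · rw [mul_zero]

theorem IsFrequencySystem.charHom_shift (hf : IsFrequencySystem N M freq) (c : Fin N → ZMod p)
    {d : VilenkinGroup p} (hd : d ∈ H0 p) (hdN : d ∈ chain p (-N)) :
    charHom (freq c) d = ZMod.toCircle (∑ i : Fin N, c i * coord ((i : ℤ) - N) d) := by
  rw [charHom_eq_of_mem_H0 _ hd hdN]
  simp only [hf.digit_freq]

/-- The frequency of the constant string `1` has a nonzero digit at index `-1`. The consequence `G_M
⊆ G_{-N}` makes translations by `G_M` preserve the supports of the packets. -/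
theorem IsFrequencySystem.nonneg (hf : IsFrequencySystem N M freq) (hN : 1 ≤ N)
    (hp : (1 : ZMod p) ≠ 0) : 0 ≤ M := by
  by_contra! h
  have h1 := mem_annihilator_iff_digit.1 (hf.mem_annihilator fun _ => 1) (-1) (by omega)
  have h2 := hf.digit_freq (fun _ => 1) ⟨N - 1, by omega⟩
  rw [show (((⟨N - 1, by omega⟩ : Fin N) : ℕ) : ℤ) - N = -1 by simp only; omega, h1] at h2
  exact hp h2.symm

theorem IsFrequencySystem.packetSum_add (hf : IsFrequencySystem N M freq) (hN : 1 ≤ N)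
    (hp : (1 : ZMod p) ≠ 0) (x : VilenkinGroup p) {g : VilenkinGroup p} (hg : g ∈ chain p M) :
    packetSum freq lam (x + g) = packetSum freq lam x := by
  have hM := hf.nonneg hN hp
  rw [packetSum, packetSum]
  congr 1
  refine Finset.sum_congr rfl fun c _ => ?_
  rw [packet_add _ _ (chain_anti p (by omega) hg), pairing_eq,
    show charHom (freq c) g = 1 from hf.mem_annihilator c g hg, Circle.coe_one, mul_one]

theorem IsFrequencySystem.isStepFunction_packetSum (hf : IsFrequencySystem N M freq) (hN : 1 ≤ N)
    (hp : (1 : ZMod p) ≠ 0) : IsStepFunction M (-N) (packetSum freq lam) :=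
  ⟨fun _ hx => packetSum_of_notMem hx, fun x _ hg => hf.packetSum_add hN hp x hg⟩

omit [NeZero p] in
theorem coord_eq_zero_iff_of_mem {d : VilenkinGroup p} (hd : d ∈ H0 p)
    (hdN : d ∈ chain p (-N)) : (fun i : Fin N => coord ((i : ℤ) - N) d) = 0 ↔ d = 0 := by
  constructor
  · intro h
    refine VilenkinGroup.ext fun k => ?_
    rw [map_zero]
    by_cases h0 : 0 ≤ k
    · exact hd k h0
    · by_cases h1 : k < -N
      · exact hdN k h1
      · have := congrFun h ⟨(k + N).toNat, by omega⟩
        simp only [Pi.zero_apply] at this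
        rwa [show (((k + N).toNat : ℕ) : ℤ) - N = k by omega] at this
  · rintro rfl
    funext i
    simp

-- Packets of distinct frequencies are orthogonal, so the double sum collapses to `p^{-N}` times the
-- sum of the conjugates of `(freq c, d)`. As `c` varies, these are the values at `d` of all
-- characters of `(ℤ/p)^N`. A shift outside `G_{-N}` makes the supports disjoint.
open Classical in
theorem IsFrequencySystem.integral_packetSum_mul_star (hf : IsFrequencySystem N M freq)
    (hlam : ∀ c, ‖lam c‖ = 1) {d : VilenkinGroup p} (hd : d ∈ H0 p) :
    ∫ x, packetSum freq lam x * star (packetSum freq lam (x + d)) ∂haarG p =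
      if d = 0 then 1 else 0 := by
  by_cases hdN : d ∈ chain p (-N)
  · have h1 : ∀ x, packetSum freq lam x * star (packetSum freq lam (x + d)) =
        ∑ c, ∑ c', ((p : ℂ) ^ N)⁻¹ * ((p : ℂ) ^ N)⁻¹ * (lam c * star (lam c')) *
          star (pairing (freq c') d) * packet (-N) (freq c * (freq c')⁻¹) x := by
      intro x
      simp only [packetSum, packet_add _ _ hdN]
      rw [star_mul', star_sum, mul_mul_mul_comm, Finset.sum_mul_sum, Finset.mul_sum]
      refine Finset.sum_congr rfl fun c _ => ?_
      rw [Finset.mul_sum]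
      refine Finset.sum_congr rfl fun c' _ => ?_
      rw [← packet_mul_star, star_mul', star_mul', star_inv₀, star_pow, star_natCast]
      ring
    have hmem : ∀ c c', freq c * (freq c')⁻¹ ∈ annihilator p (-N) ↔ c' = c := by
      intro c c'
      constructor
      · intro h
        funext i
        rw [← hf.digit_freq c i, ← hf.digit_freq c' i]
        exact (div_mem_annihilator_iff.1 h _ (by omega)).symm
      · rintro rfl
        rw [mul_inv_cancel]
        exact one_mem _
    have hl : ∀ c, lam c * star (lam c) = 1 := by
      intro c
      rw [Complex.star_def, Complex.mul_conj, Complex.normSq_eq_norm_sq, hlam]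
      simp
    simp only [h1]
    rw [integral_finsetSum _ fun c _ => integrable_finsetSum _ fun c' _ =>
      (integrable_packet _ _).const_mul _]
    have h2 : ∀ c, ∫ x, ∑ c', ((p : ℂ) ^ N)⁻¹ * ((p : ℂ) ^ N)⁻¹ * (lam c * star (lam c')) *
          star (pairing (freq c') d) * packet (-N) (freq c * (freq c')⁻¹) x ∂haarG p =
        ((p : ℂ) ^ N)⁻¹ * star (pairing (freq c) d) := by
      intro c
      rw [integral_finsetSum _ fun c' _ => (integrable_packet _ _).const_mul _]
      simp only [integral_const_mul, integral_packet, hmem, haarG_real_chain_neg]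
      rw [Finset.sum_eq_single c (fun c' _ h => by rw [if_neg h, mul_zero]) (by simp), if_pos rfl, hl]
      push_cast
      field_simp [natCast_pow_ne_zero (p := p) (N := N)]
    simp only [h2]
    rw [← Finset.mul_sum, ← star_sum]
    simp only [pairing_eq, hf.charHom_shift _ hd hdN]
    rw [sum_toCircle_dotProduct fun i : Fin N => coord ((i : ℤ) - N) d]
    simp only [coord_eq_zero_iff_of_mem hd hdN]
    split_ifs
    · rw [star_pow, star_natCast, inv_mul_cancel₀ natCast_pow_ne_zero]
    · rw [star_zero, mul_zero]
  · rw [if_neg (by rintro rfl; exact hdN (zero_mem _))]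
    refine integral_eq_zero_of_ae (Eventually.of_forall fun x => ?_)
    by_cases hx : x ∈ chain p (-N)
    · have : x + d ∉ chain p (-N) := by rwa [AddSubgroup.add_mem_cancel_left _ hx]
      simp [packetSum_of_notMem this]
    · simp [packetSum_of_notMem hx]

theorem IsFrequencySystem.orthonormalShifts (hf : IsFrequencySystem N M freq)
    (hlam : ∀ c, ‖lam c‖ = 1) : OrthonormalShifts (packetSum freq lam) := by
  classical
  have key : ∀ h ∈ H0 p, ∀ g ∈ H0 p,
      ∫ x, packetSum freq lam (x - h) * star (packetSum freq lam (x - g)) ∂haarG p =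
        if h - g = 0 then 1 else 0 := by
    intro h hh g hg
    have := integral_sub_right_eq_self (μ := haarG p) (fun x =>
      packetSum freq lam x * star (packetSum freq lam (x + (h - g)))) h
    simp only [sub_add_sub_cancel] at this
    rw [this, hf.integral_packetSum_mul_star hlam (H0_sub_mem hh hg)]
  refine ⟨memLp_packetSum, fun h hh => ?_, fun h hh g hg hne => ?_⟩
  · rw [key h hh h hh, if_pos (sub_self h)]
  · rw [key h hh g hg, if_neg (sub_ne_zero.2 hne)]

/-- A single wave packet is a finite linear combination of shifts of the sum. -/
theorem IsFrequencySystem.sum_shifts (hf : IsFrequencySystem N M freq) (c : Fin N → ZMod p)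
    (x : VilenkinGroup p) :
    ∑ b : Fin N → ZMod p, pairing (freq c) (shiftVec b) * packetSum freq lam (x - shiftVec b) =
      lam c * packet (-N) (freq c) x := by
  -- A shift by `shiftVec b` multiplies the packet of `c'` by the conjugate of `(freq c', shiftVec
  -- b)`; weighting by `(freq c, shiftVec b)` and summing over `b` is Fourier inversion on
  -- `(ℤ/p)^N`.
  have h1 : ∀ b : Fin N → ZMod p,
      pairing (freq c) (shiftVec b) * packetSum freq lam (x - shiftVec b) =
        ∑ c', ((p : ℂ) ^ N)⁻¹ * (lam c' * packet (-N) (freq c') x) *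
          (ZMod.toCircle (∑ i, b i * (c - c') i) : ℂ) := by
    intro b
    rw [packetSum, mul_left_comm, Finset.mul_sum, Finset.mul_sum]
    refine Finset.sum_congr rfl fun c' _ => ?_
    rw [packet_sub _ _ (shiftVec_mem_chain b)]
    have h2 : pairing (freq c) (shiftVec b) * star (pairing (freq c') (shiftVec b)) =
        (ZMod.toCircle (∑ i, b i * (c - c') i) : ℂ) := by
      rw [← pairing_inv, ← pairing_mul, pairing_eq,
        charHom_eq_of_mem_H0 _ (shiftVec_mem_H0 b) (shiftVec_mem_chain b)]
      simp only [digit_mul, digit_inv, hf.digit_freq, coord_shiftVec, Pi.sub_apply,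
        ← sub_eq_add_neg, mul_comm]
    rw [← h2]
    ring
  simp only [h1]
  rw [Finset.sum_comm]
  simp only [← Finset.mul_sum, sum_toCircle_dotProduct, sub_eq_zero]
  rw [Finset.sum_eq_single c (fun c' _ h => by rw [if_neg h.symm, mul_zero]) (by simp), if_pos rfl]
  field_simp [natCast_pow_ne_zero (p := p) (N := N)]

end PacketSum

/-! ### Substitutions acting on `L_2` -/

section Substitution

variable {p : ℕ} [NeZero p]

/-- A measurable map of the group that multiplies the Haar measure by a constant. -/
structure ScalesHaar (T : VilenkinGroup p → VilenkinGroup p) : Prop where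
  measurable : Measurable T
  exists_map_eq : ∃ c : NNReal, (haarG p).map T = c • haarG p

theorem scalesHaar_add_right (g : VilenkinGroup p) : ScalesHaar fun x => x + g :=
  ⟨measurable_add_const g, 1, by rw [map_add_right_eq_self, one_smul]⟩

theorem scalesHaar_sub_right (g : VilenkinGroup p) : ScalesHaar fun x => x - g := by
  simpa only [sub_eq_add_neg] using scalesHaar_add_right (-g)

/-- The dilation `𝒜^n` as an automorphism. -/
def dilEquiv (p : ℕ) (n : ℤ) : VilenkinGroup p ≃ₜ+ VilenkinGroup p where
  toFun := dil n
  invFun := dil (-n)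
  left_inv := dil_neg_dil n
  right_inv := dil_dil_neg n
  map_add' := map_add (dil n)
  continuous_toFun := (dil n).continuous_toFun
  continuous_invFun := (dil (-n)).continuous_toFun

/-- The image of Haar measure under an automorphism is again a Haar measure, so uniqueness supplies
the factor; its value is never needed. -/
theorem scalesHaar_dil (n : ℤ) : ScalesHaar (dil n : VilenkinGroup p → VilenkinGroup p) := by
  have h1 : ((haarG p).map (dilEquiv p n)).IsAddHaarMeasure :=
    (dilEquiv p n).isAddHaarMeasure_map (haarG p)
  have h2 : ((haarG p).map (dilEquiv p n)).Regular :=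
    Measure.Regular.map (dilEquiv p n).toHomeomorph
  exact ⟨(dil n).continuous_toFun.measurable, _,
    Measure.isAddLeftInvariant_eq_smul_of_regular ((haarG p).map (dilEquiv p n)) (haarG p)⟩

namespace ScalesHaar

variable {T : VilenkinGroup p → VilenkinGroup p}

theorem memLp_comp (hT : ScalesHaar T) {f : VilenkinGroup p → ℂ} (hf : MemLp f 2 (haarG p)) :
    MemLp (fun x => f (T x)) 2 (haarG p) := by
  obtain ⟨c, hc⟩ := hT.exists_map_eq
  refine MemLp.comp_of_map ?_ hT.measurable.aemeasurable
  rw [hc]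
  exact hf.smul_measure ENNReal.coe_ne_top

theorem ae_eq_comp (hT : ScalesHaar T) {f g : VilenkinGroup p → ℂ} (h : f =ᵐ[haarG p] g) :
    (fun x => f (T x)) =ᵐ[haarG p] fun x => g (T x) := by
  obtain ⟨c, hc⟩ := hT.exists_map_eq
  refine _root_.MeasureTheory.ae_eq_comp hT.measurable.aemeasurable ?_
  rw [hc]
  exact (Measure.smul_absolutelyContinuous (c := c)).ae_eq h

theorem exists_eLpNorm_comp_le (hT : ScalesHaar T) :
    ∃ C : NNReal, ∀ f : VilenkinGroup p → ℂ, MemLp f 2 (haarG p) →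
      eLpNorm (fun x => f (T x)) 2 (haarG p) ≤ C * eLpNorm f 2 (haarG p) := by
  obtain ⟨c, hc⟩ := hT.exists_map_eq
  refine ⟨c ^ (1 / (2 : ENNReal)).toReal, fun f hf => ?_⟩
  have h1 : AEStronglyMeasurable f ((haarG p).map T) := by
    rw [hc]
    exact (hf.smul_measure (c := (c : ENNReal)) ENNReal.coe_ne_top).aestronglyMeasurable
  have h2 := eLpNorm_map_measure (p := 2) h1 hT.measurable.aemeasurable
  rw [show (fun x => f (T x)) = f ∘ T from rfl, ← h2, hc,
    ENNReal.coe_rpow_of_nonneg _ ENNReal.toReal_nonneg]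
  exact eLpNorm_smul_measure_le (c : ENNReal) f 2 (haarG p)

/-- Composition with `T` as a linear map on `L_2`. -/
def compLinear (hT : ScalesHaar T) : L2 p →ₗ[ℂ] L2 p where
  toFun f := (hT.memLp_comp (Lp.memLp f)).toLp _
  map_add' f g := by
    refine Lp.ext ?_
    filter_upwards [(hT.memLp_comp (Lp.memLp (f + g))).coeFn_toLp,
      (hT.memLp_comp (Lp.memLp f)).coeFn_toLp, (hT.memLp_comp (Lp.memLp g)).coeFn_toLp,
      hT.ae_eq_comp (Lp.coeFn_add f g), Lp.coeFn_add ((hT.memLp_comp (Lp.memLp f)).toLp _)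
        ((hT.memLp_comp (Lp.memLp g)).toLp _)] with x h1 h2 h3 h4 h5
    rw [h1, h4, h5, Pi.add_apply, Pi.add_apply, h2, h3]
  map_smul' c f := by
    refine Lp.ext ?_
    filter_upwards [(hT.memLp_comp (Lp.memLp (c • f))).coeFn_toLp,
      (hT.memLp_comp (Lp.memLp f)).coeFn_toLp, hT.ae_eq_comp (Lp.coeFn_smul c f),
      Lp.coeFn_smul c ((hT.memLp_comp (Lp.memLp f)).toLp _)] with x h1 h2 h3 h4
    rw [RingHom.id_apply, h1, h3, h4, Pi.smul_apply, Pi.smul_apply, h2]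

theorem exists_norm_compLinear_le (hT : ScalesHaar T) :
    ∃ C : ℝ, ∀ f, ‖hT.compLinear f‖ ≤ C * ‖f‖ := by
  obtain ⟨C, hC⟩ := hT.exists_eLpNorm_comp_le
  refine ⟨C, fun f => ?_⟩
  have h1 : ‖hT.compLinear f‖ = (eLpNorm (fun x => f (T x)) 2 (haarG p)).toReal :=
    Lp.norm_toLp _ (hT.memLp_comp (Lp.memLp f))
  rw [h1, Lp.norm_def, ← ENNReal.coe_toReal, ← ENNReal.toReal_mul]
  exact ENNReal.toReal_mono (ENNReal.mul_ne_top ENNReal.coe_ne_top (Lp.eLpNorm_ne_top f))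
    (hC f (Lp.memLp f))

/-- Composition with `T` as an operator on `L_2`. -/
def compL2 (hT : ScalesHaar T) : L2 p →L[ℂ] L2 p :=
  hT.compLinear.mkContinuousOfExistsBound hT.exists_norm_compLinear_le

theorem coeFn_compL2 (hT : ScalesHaar T) (f : L2 p) :
    hT.compL2 f =ᵐ[haarG p] fun x => f (T x) :=
  (hT.memLp_comp (Lp.memLp f)).coeFn_toLp

theorem compL2_toLp (hT : ScalesHaar T) {f : VilenkinGroup p → ℂ} (hf : MemLp f 2 (haarG p)) :
    hT.compL2 (hf.toLp f) = (hT.memLp_comp hf).toLp _ :=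
  Lp.ext ((hT.coeFn_compL2 _).trans
    ((hT.ae_eq_comp hf.coeFn_toLp).trans (hT.memLp_comp hf).coeFn_toLp.symm))

end ScalesHaar

end Substitution

/-! ### Functions in the spaces `V_n` -/

section FunMem

variable {p : ℕ} [NeZero p] {V : Submodule ℂ (L2 p)}

theorem FunMem.const_mul {f : VilenkinGroup p → ℂ} (hf : FunMem f V) (c : ℂ) :
    FunMem (fun x => c * f x) V := by
  obtain ⟨h1, h2⟩ := hf
  exact ⟨h1.const_mul c, V.smul_mem c h2⟩

theorem FunMem.add {f g : VilenkinGroup p → ℂ} (hf : FunMem f V) (hg : FunMem g V) :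
    FunMem (fun x => f x + g x) V := by
  obtain ⟨h1, h2⟩ := hf
  obtain ⟨h3, h4⟩ := hg
  exact ⟨h1.add h3, V.add_mem h2 h4⟩

theorem FunMem.sum {ι : Type*} (s : Finset ι) {f : ι → VilenkinGroup p → ℂ}
    (hf : ∀ i ∈ s, FunMem (f i) V) : FunMem (fun x => ∑ i ∈ s, f i x) V := by
  classical
  induction s using Finset.induction_on with
  | empty =>
    simp only [Finset.sum_empty]
    exact ⟨MemLp.zero', V.zero_mem⟩
  | insert i s hi ih =>
    simp only [Finset.sum_insert hi]
    exact (hf i (Finset.mem_insert_self i s)).add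
      (ih fun j hj => hf j (Finset.mem_insert_of_mem hj))

theorem isClosed_mraSpace (φ : VilenkinGroup p → ℂ) (n : ℤ) :
    IsClosed (mraSpace φ n : Set (L2 p)) := Submodule.isClosed_topologicalClosure _

theorem mem_mraSpace {φ : VilenkinGroup p → ℂ} {n : ℤ} {f : L2 p} {h : VilenkinGroup p}
    (hh : h ∈ H0 p) (hf : f =ᵐ[haarG p] fun x => φ (dil n x - h)) : f ∈ mraSpace φ n :=
  Submodule.le_topologicalClosure _ (Submodule.subset_span ⟨h, hh, hf⟩)

theorem mraSpace_le {φ : VilenkinGroup p → ℂ} {n : ℤ} (hV : IsClosed (V : Set (L2 p)))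
    (h : ∀ f : L2 p, ∀ h ∈ H0 p, f =ᵐ[haarG p] (fun x => φ (dil n x - h)) → f ∈ V) :
    mraSpace φ n ≤ V := by
  refine Submodule.topologicalClosure_minimal _ (Submodule.span_le.2 ?_) hV
  rintro f ⟨g, hg, hf⟩
  exact h f g hg hf

theorem funMem_shift {φ : VilenkinGroup p → ℂ} (hφ : MemLp φ 2 (haarG p)) (n : ℤ)
    {h : VilenkinGroup p} (hh : h ∈ H0 p) :
    FunMem (fun x => φ (dil n x - h)) (mraSpace φ n) := by
  have h1 : MemLp (fun x => φ (x - h)) 2 (haarG p) := (scalesHaar_sub_right h).memLp_comp hφ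
  have h2 := (scalesHaar_dil n).memLp_comp h1
  exact ⟨h2, mem_mraSpace hh h2.coeFn_toLp⟩

/-- Composition with `T` is bounded on `L_2`, so the preimage of `mraSpace φ m` is closed and
inclusion need only be checked on generators. -/
theorem FunMem.comp {φ f : VilenkinGroup p → ℂ} {n m : ℤ} (hf : FunMem f (mraSpace φ n))
    {T : VilenkinGroup p → VilenkinGroup p} (hT : ScalesHaar T)
    (h : ∀ h ∈ H0 p, ∃ h' ∈ H0 p, ∀ x, dil n (T x) - h = dil m x - h') :
    FunMem (fun x => f (T x)) (mraSpace φ m) := by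
  obtain ⟨hf, hfV⟩ := hf
  have key : mraSpace φ n ≤ (mraSpace φ m).comap hT.compL2.toLinearMap := by
    refine mraSpace_le ((isClosed_mraSpace φ m).preimage hT.compL2.continuous) fun g k hk hg => ?_
    obtain ⟨k', hk', hkk⟩ := h k hk
    refine mem_mraSpace hk' ?_
    filter_upwards [hT.coeFn_compL2 g, hT.ae_eq_comp hg] with x h1 h2
    exact h1.trans (h2.trans (congrArg φ (hkk x)))
  refine ⟨hT.memLp_comp hf, ?_⟩
  rw [← hT.compL2_toLp hf]
  exact key hfV

theorem FunMem.comp_dil {φ f : VilenkinGroup p → ℂ} {n : ℤ} (hf : FunMem f (mraSpace φ n))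
    (k : ℤ) : FunMem (fun x => f (dil k x)) (mraSpace φ (n + k)) :=
  hf.comp (scalesHaar_dil k) fun h hh => ⟨h, hh, fun x => by rw [dil_add]⟩

theorem FunMem.comp_sub {φ f : VilenkinGroup p → ℂ} {n : ℤ} (hf : FunMem f (mraSpace φ n))
    {h : VilenkinGroup p} (hh : h ∈ H0 p) :
    FunMem (fun x => f (x - dil (-n) h)) (mraSpace φ n) :=
  hf.comp (scalesHaar_sub_right _) fun g hg => ⟨h + g, H0_add_mem hh hg, fun x => by
    rw [map_sub, dil_dil_neg, sub_sub]⟩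

end FunMem

/-! ### Multiresolution analysis generated by a sum of wave packets -/

section MRA

variable {p : ℕ} [NeZero p] {N : ℕ} {M : ℤ} {freq : (Fin N → ZMod p) → CharGroup p}
  {lam : (Fin N → ZMod p) → ℂ}

theorem IsFrequencySystem.funMem_packet (hf : IsFrequencySystem N M freq)
    (hlam : ∀ c, ‖lam c‖ = 1) {ψ : CharGroup p} {c : Fin N → ZMod p}
    (hc : ψ * (freq c)⁻¹ ∈ annihilator p (-N)) :
    FunMem (packet (-N) ψ) (mraSpace (packetSum freq lam) 0) := by
  have h0 : lam c ≠ 0 := norm_ne_zero_iff.1 (by rw [hlam]; exact one_ne_zero)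
  have h1 := (FunMem.sum (Finset.univ : Finset (Fin N → ZMod p)) fun b _ =>
    (funMem_shift (memLp_packetSum (freq := freq) (lam := lam)) 0
      (shiftVec_mem_H0 b)).const_mul (pairing (freq c) (shiftVec b))).const_mul (lam c)⁻¹
  simp only [dil_zero, hf.sum_shifts, inv_mul_cancel_left₀ h0] at h1
  rwa [packet_congr hc]

-- Because `(freq c)𝒜^{-1}` lies in the coset of some `freq c'`, its packet on `G_{-N}` belongs to
-- `V_0`; dilated, it becomes the packet of `freq c` on `G_{1-N}`, in `V_1`. The `p` translates of
-- the latter, with suitable phases, tile the packet of `freq c` on `G_{-N}`.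
open Classical in
theorem IsFrequencySystem.funMem_packetSum_one (hf : IsFrequencySystem N M freq) (hN : 1 ≤ N)
    (hlam : ∀ c, ‖lam c‖ = 1) :
    FunMem (packetSum freq lam) (mraSpace (packetSum freq lam) 1) := by
  refine (FunMem.sum _ fun c _ => FunMem.const_mul ?_ (lam c)).const_mul _
  obtain ⟨c', hc'⟩ := hf.exists_charDil c
  have h1 := (hf.funMem_packet hlam hc').comp_dil 1
  have h2 : ∀ a : ZMod p, a.val • unitVec p (-N) =
      dil (-1) (a.val • unitVec p (-N - 1)) := fun a => by
    rw [map_nsmul, dil_unitVec]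
    congr 2
    ring
  have h3 : ∀ a : ZMod p, a.val • unitVec p (-N - 1) ∈ H0 p := fun a k hk => by
    rw [map_nsmul, coord_unitVec, if_neg (by omega), nsmul_zero]
  have h4 : charDil 1 (charDil (-1) (freq c)) = freq c := charHom_ext fun x => by
    rw [charHom_charDil, charHom_charDil, dil_neg_dil]
  rw [zero_add] at h1
  simp only [packet_dil, h4] at h1
  have h5 := FunMem.sum Finset.univ fun (a : ZMod p) _ => (h1.comp_sub (h3 a)).const_mul
    (pairing (freq c) (a.val • unitVec p (-N)))
  simp only [← h2] at h5
  convert h5 using 1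
  ext x
  have h6 : ∀ a : ZMod p, pairing (freq c) (a.val • unitVec p (-N)) *
      packet (1 + -N) (freq c) (x - a.val • unitVec p (-N)) =
        if x ∈ chain p (-N) ∧ coord (-N) x = a then pairing (freq c) x else 0 := by
    intro a
    split_ifs with h
    · rw [add_comm, packet_of_mem (sub_nsmul_unitVec_mem_chain_iff.2 h), ← pairing_add,
        add_sub_cancel]
    · rw [add_comm, packet_of_notMem (mt sub_nsmul_unitVec_mem_chain_iff.1 h), mul_zero]
  simp only [h6]
  by_cases hx : x ∈ chain p (-N)
  · simp [packet_of_mem hx, hx]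
  · simp [packet_of_notMem hx, hx]

theorem IsFrequencySystem.mraSpace_le_succ (hf : IsFrequencySystem N M freq) (hN : 1 ≤ N)
    (hlam : ∀ c, ‖lam c‖ = 1) (n : ℤ) :
    mraSpace (packetSum freq lam) n ≤ mraSpace (packetSum freq lam) (n + 1) := by
  refine mraSpace_le (isClosed_mraSpace _ _) fun f h hh hfh => ?_
  -- In `V_1` shifts by `𝒜^{-1} H_0` are allowed; they include `h = 𝒜^{-1}(𝒜 h)`, since `𝒜` maps
  -- `H_0` into itself.
  have h1 := ((hf.funMem_packetSum_one hN hlam).comp_sub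
    (dil_mem_H0 (n := 1) (by norm_num) hh)).comp_dil n
  rw [add_comm] at h1
  simp only [dil_neg_dil] at h1
  obtain ⟨h2, h3⟩ := h1
  rwa [show f = h2.toLp _ from Lp.ext (hfh.trans h2.coeFn_toLp.symm)]

/-- Indicators of cosets belong to the spaces of the multiresolution analysis. -/
theorem IsFrequencySystem.funMem_coset (hf : IsFrequencySystem N M freq)
    (hlam : ∀ c, ‖lam c‖ = 1) (m : ℤ) (v : VilenkinGroup p) :
    FunMem (fun x => packet m 1 (x - v)) (mraSpace (packetSum freq lam) (m + N)) := by
  have h1 := (hf.funMem_packet hlam (ψ := 1) (c := 0)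
    (by rw [one_mul]; exact inv_mem hf.freq_zero)).comp_dil (m + N)
  simp only [packet_dil, zero_add] at h1
  have h2 : charDil (m + N) (1 : CharGroup p) = 1 := charHom_ext fun x => rfl
  rw [h2, add_neg_cancel_right] at h1
  -- Only shifts by `𝒜^{-(m+N)} H_0` are available. The part of `𝒜^{m+N} v` with negative indices
  -- gives one that differs from `v` by an element of `G_m`, which does not change the coset.
  obtain ⟨k, hk⟩ := exists_mem_chain (dil (m + N) v)
  have h3 := sub_boxVec_mem_chain 0 hk
  set h := boxVec k 0 fun j => coord j (dil (m + N) v)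
  have h4 : v - dil (-(m + N)) h ∈ chain p m := by
    refine chain_anti p (show m ≤ m + N by omega) ?_
    have := (dil_mem_chain_iff (n := m + N) (m := 0) (x := v - dil (-(m + N)) h)).1
      (by rwa [map_sub, dil_dil_neg])
    rwa [add_zero] at this
  convert h1.comp_sub (h := h) (boxVec_mem_H0 _ _) using 2 with x
  rw [show x - v = x - dil (-(m + N)) h - (v - dil (-(m + N)) h) by abel, packet_sub _ _ h4,
    pairing_eq, charHom_one]
  simp

end MRA

/-! ### Density and intersection -/

section Approximation

variable {p : ℕ} [NeZero p]

omit [NeZero p] in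
theorem subset_chain_of_isCompact {K : Set (VilenkinGroup p)} (hK : IsCompact K) :
    ∃ n : ℕ, K ⊆ chain p (-n) := by
  refine hK.elim_directed_cover (fun n : ℕ => (chain p (-n) : Set (VilenkinGroup p)))
    (fun n => isOpen_chain p _) (fun x _ => ?_) ?_
  · obtain ⟨m, hm⟩ := exists_mem_chain x
    exact Set.mem_iUnion.2 ⟨(-m).toNat, chain_anti p (by omega) hm⟩
  · exact directed_of_isDirected_le fun a b hab => chain_anti p (by omega)

instance : SigmaCompactSpace (VilenkinGroup p) :=
  ⟨⟨fun n : ℕ => chain p (-n), fun n => isCompact_chain _, by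
    refine Set.eq_univ_of_forall fun x => ?_
    obtain ⟨n, hn⟩ := subset_chain_of_isCompact (isCompact_singleton (x := x))
    exact Set.mem_iUnion.2 ⟨n, hn rfl⟩⟩⟩

instance : NormalSpace (VilenkinGroup p) := NormalSpace.of_regularSpace_lindelofSpace

omit [NeZero p] in
theorem sub_shiftVec_mem_chain_zero_iff {k : ℕ} {y : VilenkinGroup p} {b : Fin k → ZMod p} :
    y - shiftVec b ∈ chain p 0 ↔
      y ∈ chain p (-k) ∧ b = fun i : Fin k => coord ((i : ℤ) - k) y := by
  constructor
  · intro h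
    refine ⟨?_, ?_⟩
    · rw [← sub_add_cancel y (shiftVec b)]
      exact add_mem (chain_anti p (by omega) h) (shiftVec_mem_chain b)
    · funext i
      have := h ((i : ℤ) - k) (by omega)
      rw [map_sub, coord_shiftVec, sub_eq_zero] at this
      exact this.symm
  · rintro ⟨h1, h2⟩ j hj
    by_cases hjk : j < -k
    · rw [map_sub, h1 j hjk, shiftVec_mem_chain b j hjk, sub_zero]
    · have := congrFun h2 ⟨(j + k).toNat, by omega⟩
      rw [← coord_shiftVec b] at this
      simp only [show (((j + k).toNat : ℕ) : ℤ) - k = j by omega] at this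
      rw [map_sub, this, sub_self]

/-- Continuous functions with compact support are uniformly close to combinations of indicators of
cosets of `G_m`. -/
theorem exists_sum_coset_near {g : VilenkinGroup p → ℂ} (hg : Continuous g) {K : ℕ}
    (hK : ∀ x ∉ chain p (-K), g x = 0) {δ : ℝ} (hδ : 0 < δ) :
    ∃ (m : ℤ) (ι : Type) (_ : Fintype ι) (a : ι → ℂ) (v : ι → VilenkinGroup p), ∀ x,
      ‖g x - ∑ i, a i * packet m 1 (x - v i)‖ ≤ ‖(δ : ℂ) * packet (-K) 1 x‖ := by
  have hev : ∀ᶠ t in 𝓝 (0 : VilenkinGroup p), ∀ x ∈ (chain p (-K) : Set (VilenkinGroup p)),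
      ‖g (x + t) - g x‖ < δ := by
    refine (isCompact_chain _).eventually_forall_of_forall_eventually fun x _ => ?_
    have hc : Continuous fun z : VilenkinGroup p × VilenkinGroup p => ‖g (z.2 + z.1) - g z.2‖ := by
      fun_prop
    have h0 := hc.tendsto (0, x)
    simp only [add_zero, sub_self, norm_zero] at h0
    exact h0.eventually_lt_const hδ
  obtain ⟨m₀, -, hm₀⟩ := (nhds_zero_hasBasis p).mem_iff.1 hev
  -- This choice yields `m ≥ m₀` and `m ≥ -K`, so that `G_{-K}` splits into `p ^ k` cosets of `G_m`;
  -- the points `v b` represent them, with coordinates `b` at the indices `-K, …, m - 1`.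
  set k : ℕ := (m₀ + K).toNat with hk
  set m : ℤ := k - K with hm
  have hmem : ∀ t ∈ chain p m, ∀ x ∈ chain p (-K), ‖g (x + t) - g x‖ < δ :=
    fun t ht => hm₀ (chain_anti p (by omega) ht)
  let v : (Fin k → ZMod p) → VilenkinGroup p := fun b => dil (-m) (shiftVec b)
  have hv : ∀ x b, x - v b ∈ chain p m ↔
      x ∈ chain p (-K) ∧ b = fun i : Fin k => coord ((i : ℤ) - k) (dil m x) := by
    intro x b
    have h1 : x - v b ∈ chain p m ↔ dil m (x - v b) ∈ chain p 0 := by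
      rw [dil_mem_chain_iff, add_zero]
    rw [h1, map_sub, dil_dil_neg, sub_shiftVec_mem_chain_zero_iff, dil_mem_chain_iff,
      show m + -(k : ℤ) = -K by omega]
  refine ⟨m, Fin k → ZMod p, inferInstance, fun b => g (v b), v, fun x => ?_⟩
  have hone : ∀ (n : ℤ) (y : VilenkinGroup p), y ∈ chain p n → packet n 1 y = 1 := by
    intro n y hy
    rw [packet_of_mem hy, pairing_eq, charHom_one, Circle.coe_one]
  by_cases hx : x ∈ chain p (-K)
  · set b : Fin k → ZMod p := fun i => coord ((i : ℤ) - k) (dil m x) with hb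
    have hxb : x - v b ∈ chain p m := (hv x b).2 ⟨hx, rfl⟩
    rw [Finset.sum_eq_single b (fun c _ hc => by
      rw [packet_of_notMem fun h => hc ((hv x c).1 h).2, mul_zero]) (by simp), hone _ _ hxb,
      hone _ _ hx, mul_one, mul_one, Complex.norm_real, Real.norm_of_nonneg hδ.le]
    have hvb : v b ∈ chain p (-K) := by
      rw [← sub_sub_cancel x (v b)]
      exact sub_mem hx (chain_anti p (by omega) hxb)
    have := hmem _ hxb _ hvb
    rw [add_sub_cancel] at this
    exact this.le
  · rw [hK x hx, packet_of_notMem hx, Finset.sum_eq_zero]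
    · simp
    · intro b _
      rw [packet_of_notMem fun h => hx ((hv x b).1 h).1, mul_zero]

/-- If the indicators of all cosets belong to a directed union of subspaces, then this union is
dense. -/
theorem dense_iUnion_of_cosets {V : ℤ → Submodule ℂ (L2 p)} {r : ℤ}
    (hV : ∀ (m : ℤ) (v : VilenkinGroup p), FunMem (fun x => packet m 1 (x - v)) (V (m + r))) :
    Dense (⋃ n, (V n : Set (L2 p))) := by
  refine Metric.dense_iff.2 fun f ε hε => ?_
  obtain ⟨g, hgs, hfg, hgc, hgm⟩ := (Lp.memLp f).exists_hasCompactSupport_eLpNorm_sub_le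
    (by norm_num) (ε := ENNReal.ofReal (ε / 2)) (by simpa using hε)
  obtain ⟨K, hK⟩ := subset_chain_of_isCompact hgs.isCompact
  have hK' : ∀ x ∉ chain p (-K), g x = 0 := fun x hx =>
    image_eq_zero_of_notMem_tsupport fun h => hx (hK h)
  set C : ℝ := ‖(memLp_packet (-(K : ℤ)) (1 : CharGroup p)).toLp _‖ with hC
  have hC0 : 0 ≤ C := norm_nonneg _
  -- `C` is the `L_2` norm of the indicator of `G_{-K}`, which converts the pointwise bound into a
  -- norm bound; `C + 1` keeps the denominator positive.
  have hδ : 0 < ε / 2 / (C + 1) := by positivity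
  obtain ⟨m, ι, _, a, v, hS⟩ := exists_sum_coset_near hgc hK' hδ
  obtain ⟨hSm, hSV⟩ := FunMem.sum Finset.univ fun i _ => (hV m (v i)).const_mul (a i)
  refine ⟨hSm.toLp _, ?_, Set.mem_iUnion.2 ⟨m + r, hSV⟩⟩
  have h1 : ‖f - hgm.toLp g‖ ≤ ε / 2 := by
    have : f - hgm.toLp g = ((Lp.memLp f).sub hgm).toLp _ := by
      rw [MemLp.toLp_sub (Lp.memLp f) hgm, Lp.toLp_coeFn]
    rw [this, Lp.norm_toLp]
    exact ENNReal.toReal_le_of_le_ofReal (by positivity) hfg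
  have h2 : ‖hgm.toLp g - hSm.toLp _‖ ≤ ε / 2 / (C + 1) * C := by
    have hp := memLp_packet (-(K : ℤ)) (1 : CharGroup p)
    have h3 : ‖hgm.toLp g - hSm.toLp _‖ ≤
        ‖((ε / 2 / (C + 1) : ℝ) : ℂ) • hp.toLp _‖ := by
      refine Lp.norm_le_norm_of_ae_le ?_
      filter_upwards [Lp.coeFn_sub (hgm.toLp g) (hSm.toLp _), hgm.coeFn_toLp, hSm.coeFn_toLp,
        Lp.coeFn_smul ((ε / 2 / (C + 1) : ℝ) : ℂ) (hp.toLp _), hp.coeFn_toLp]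
        with x e1 e2 e3 e4 e5
      rw [e1, e4, Pi.sub_apply, Pi.smul_apply, e2, e3, e5, smul_eq_mul]
      exact hS x
    rwa [norm_smul, Complex.norm_real, Real.norm_of_nonneg hδ.le] at h3
  have h4 : ε / 2 / (C + 1) * C < ε / 2 := by
    rw [div_mul_eq_mul_div, div_lt_iff₀ (by positivity)]
    nlinarith
  rw [Metric.mem_ball, dist_comm, dist_eq_norm]
  calc ‖f - hSm.toLp _‖ ≤ ‖f - hgm.toLp g‖ + ‖hgm.toLp g - hSm.toLp _‖ :=
        norm_sub_le_norm_sub_add_norm_sub _ _ _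
    _ < ε := by linarith

/-- A square integrable function that is invariant under all translations vanishes. -/
theorem eq_zero_of_translation_invariant (hp : (1 : ZMod p) ≠ 0) {f : L2 p}
    (hf : ∀ g : VilenkinGroup p, (fun x => f (x + g)) =ᵐ[haarG p] f) : f = 0 := by
  set F : VilenkinGroup p → ENNReal := fun x => ‖f x‖ₑ ^ (2 : ℝ) with hF
  have hFm : Measurable F := (Lp.stronglyMeasurable f).measurable.enorm.pow_const _
  set ρ := (haarG p).withDensity F with hρ
  have hfin : ρ Set.univ ≠ ⊤ := by
    rw [hρ, withDensity_apply _ MeasurableSet.univ, Measure.restrict_univ]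
    have := lintegral_rpow_enorm_lt_top_of_eLpNorm_lt_top (by norm_num) (by norm_num)
      (Lp.memLp f).2
    simpa [hF] using this.ne
  -- The measure `ρ` with density `|f|²` is finite and invariant under translations. A translate of
  -- `G_{-n}` by a vector outside it is disjoint and of equal mass; letting `n` grow forces the
  -- total mass to satisfy `2ρ ≤ ρ`.
  have hdouble : ∀ n : ℕ, 2 * ρ (chain p (-n)) ≤ ρ Set.univ := by
    intro n
    set g := unitVec p (-n - 1) with hg
    have hgn : g ∉ chain p (-n) := fun h => by
      have := h (-n - 1) (by omega)
      rw [hg, coord_unitVec, if_pos rfl] at this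
      exact hp this
    have hA := measurableSet_chain (p := p) (-n)
    have hB : MeasurableSet ((fun x => x + -g) ⁻¹' (chain p (-n) : Set (VilenkinGroup p))) :=
      measurable_add_const _ hA
    have h1 : ρ ((fun x => x + -g) ⁻¹' (chain p (-n) : Set (VilenkinGroup p))) =
        ρ (chain p (-n)) := by
      rw [hρ, withDensity_apply _ hB, withDensity_apply _ hA, ← lintegral_indicator hB,
        ← lintegral_indicator hA, ← lintegral_add_right_eq_self _ g]
      refine lintegral_congr_ae ?_
      filter_upwards [hf g] with x hx
      have hx' : F (x + g) = F x := by simp only [hF, hx]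
      by_cases h : x ∈ chain p (-n)
      · rw [Set.indicator_of_mem (show x ∈ (chain p (-n) : Set (VilenkinGroup p)) from h),
          Set.indicator_of_mem (by simpa using h), hx']
      · rw [Set.indicator_of_notMem (show x ∉ (chain p (-n) : Set (VilenkinGroup p)) from h),
          Set.indicator_of_notMem (by simpa using h)]
    have hd : Disjoint (chain p (-n) : Set (VilenkinGroup p))
        ((fun x => x + -g) ⁻¹' (chain p (-n) : Set (VilenkinGroup p))) := by
      refine Set.disjoint_left.2 fun x hx hx' => hgn ?_
      have := sub_mem (show x ∈ chain p (-n) from hx) (show x + -g ∈ chain p (-n) from hx')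
      simpa using this
    rw [two_mul]
    nth_rewrite 2 [← h1]
    rw [← measure_union hd hB]
    exact measure_mono (Set.subset_univ _)
  have hU : (⋃ n : ℕ, (chain p (-n) : Set (VilenkinGroup p))) = Set.univ := by
    refine Set.eq_univ_of_forall fun x => ?_
    obtain ⟨n, hn⟩ := subset_chain_of_isCompact (isCompact_singleton (x := x))
    exact Set.mem_iUnion.2 ⟨n, hn rfl⟩
  have hsup : ρ Set.univ = ⨆ n : ℕ, ρ (chain p (-n)) := by
    rw [← hU]
    exact Monotone.measure_iUnion fun a b hab => chain_anti p (by omega)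
  have h2 : 2 * ρ Set.univ ≤ ρ Set.univ := by
    nth_rewrite 1 [hsup]
    rw [ENNReal.mul_iSup]
    exact iSup_le hdouble
  have h3 : ρ Set.univ = 0 := by
    rw [two_mul] at h2
    by_contra h0
    exact absurd h2 (not_le.2 (ENNReal.lt_add_right hfin h0))
  rw [hρ, withDensity_apply _ MeasurableSet.univ, Measure.restrict_univ,
    lintegral_eq_zero_iff hFm] at h3
  refine Lp.ext ?_
  filter_upwards [h3, Lp.coeFn_zero ℂ 2 (haarG p)] with x h4 h5
  rw [h5]
  simpa [hF] using h4

end Approximation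

/-! ### Trivial intersection and the complete multiresolution analysis -/

section MRA

variable {p : ℕ} [NeZero p] {N : ℕ} {M : ℤ} {freq : (Fin N → ZMod p) → CharGroup p}
  {lam : (Fin N → ZMod p) → ℂ}

theorem IsFrequencySystem.iInter_mraSpace (hf : IsFrequencySystem N M freq) (hN : 1 ≤ N)
    (hp : (1 : ZMod p) ≠ 0) :
    ⋂ n, (mraSpace (packetSum freq lam) n : Set (L2 p)) = {0} := by
  refine Set.Subset.antisymm (fun f hfV => ?_) ?_
  · refine eq_zero_of_translation_invariant hp fun g => ?_
    obtain ⟨m, hm⟩ := exists_mem_chain g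
    set T := scalesHaar_add_right g
    -- The level `m - M` is chosen so that `𝒜^{m-M}` maps `g ∈ G_m` into `G_M`, the periods of `φ`.
    -- The fixed vectors of a bounded operator form a closed subspace, so generators suffice.
    have hinv : mraSpace (packetSum freq lam) (m - M) ≤
        LinearMap.eqLocus T.compL2.toLinearMap LinearMap.id := by
      refine mraSpace_le (isClosed_eq T.compL2.continuous continuous_id) fun u h hh hu => ?_
      refine Lp.ext ?_
      filter_upwards [T.coeFn_compL2 u, T.ae_eq_comp hu, hu] with x h1 h2 h3
      refine h1.trans (h2.trans (Eq.trans ?_ h3.symm))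
      rw [map_add, add_sub_right_comm, hf.packetSum_add hN hp]
      exact dil_mem_chain_iff.2 (by simpa using hm)
    have h1 : T.compL2 f = f := hinv (Set.mem_iInter.1 hfV (m - M))
    have h2 := T.coeFn_compL2 f
    rw [h1] at h2
    exact h2.symm
  · rintro _ rfl
    exact Set.mem_iInter.2 fun n => Submodule.zero_mem _

theorem IsFrequencySystem.generatesMRA (hf : IsFrequencySystem N M freq) (hN : 1 ≤ N)
    (hp : (1 : ZMod p) ≠ 0) (hlam : ∀ c, ‖lam c‖ = 1) : GeneratesMRA (packetSum freq lam) where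
  orthonormal := hf.orthonormalShifts hlam
  isMRA :=
    { closed := isClosed_mraSpace _
      mono := hf.mraSpace_le_succ hN hlam
      dense := dense_iUnion_of_cosets (hf.funMem_coset hlam)
      inter := hf.iInter_mraSpace hN hp
      dilation := fun n f => by
        refine ⟨fun h => h.comp_dil 1, fun h => ?_⟩
        have h1 := h.comp_dil (-1)
        simpa only [dil_dil_neg, add_neg_cancel_right] using h1
      shift := fun f h g hg => by
        have h1 := h.comp_sub hg
        simpa only [neg_zero, dil_zero] using h1
      scaling := ⟨_, hf.orthonormalShifts hlam, by simp only [mraSpace, dil_zero]⟩ }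

end MRA

end

end NValidTree

theorem theorem4p2 (p : ℕ) [Fact p.Prime] (hp : 3 ≤ p) (N : ℕ) (hN : 1 ≤ N)
    (T : RootedTree) (label : T → ZMod p) (hT : IsNValid N T label)
    (m₀ : CharGroup p → ℂ) (hm : IsTreeMask N T label m₀) :
    IsStepFunction ((height T : ℤ) - 2 * N) (-N) (generatedFunction m₀) ∧
      (∀ χ, Multipliable fun n : ℕ => m₀ (charDil (-(n : ℤ)) χ)) ∧
      Integrable (generatedFunction m₀) (haarG p) ∧
      (∀ χ, fourierG (generatedFunction m₀) χ = phiHat m₀ χ) ∧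
      GeneratesMRA (generatedFunction m₀) := by
  have h1 : (1 : ZMod p) ≠ 0 := one_ne_zero
  obtain ⟨freq, hf, hlam, hF⟩ := hm.exists_frequencySystem hT hN h1
  rw [generatedFunction, inverseFourierX_eq_packetSum hF]
  exact ⟨hf.isStepFunction_packetSum hN h1, hm.multipliable, integrable_packetSum,
    fun χ => (fourierG_packetSum χ).trans (hF χ).symm, hf.generatesMRA hN h1 hlam⟩
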